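/- Let $\mathfrak K$ be a field, let $\Gamma$ be a finite quiver (paths are composed from right to left), let $I$ be an admissible ideal of the path algebra $\mathfrak K\Gamma$, and let $\Lambda=\mathfrak K\Gamma/I$, with Jacobson radical $J$. A module is uniserial if it has exactly one composition series (the zero module counts as uniserial). Let $m$ be a natural number and suppose that $\Lambda$ is left $m$-multiserial, i.e. for each primitive idempotent $e$ of $\Lambda$ the left ideal $Je$ is a (not necessarily direct) sum of $m$ uniserial $\Lambda$-modules. Let $U$ be a finitely generated non-projective uniserial left $\Lambda$-module of length $n$, and let $p$ be a mast of $U$, i.e. a path in $\Gamma$ of length $n-1$ such that $px\neq 0$ for some $x\in U$; let $\mathrm s(p)$ be its starting vertex. Let $\alpha(U)$ be the number of summands in a decomposition of the middle term $B$ into indecomposable modules, where $0\to A\to B\to U\to 0$ is an almost split sequence of finitely generated left $\Lambda$-modules; such a sequence exists, and the number depends only on $U$. Then: (i) if $m=1$, then $\alpha(U)\le 2$; (ii) if there is exactly one arrow of $\Gamma$ that starts at $\mathrm s(p)$, then $\alpha(U)\le 2$; (iii) if $m=2$ and $Jp=0$ in $\Lambda$, then $\alpha(U)=1$. -/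

import Mathlib

universe u

/-! ### Path algebras -/

/-- The paths of a quiver, including the trivial paths, together with their endpoints:
`⟨a, b, p⟩` is the path `p` from `a` to `b`. -/
abbrev QuiverPath (V : Type u) [Quiver.{u} V] : Type u :=
  Σ a b : V, Quiver.Path a b

/-- The path algebra of a quiver: the vector space with basis the set of all paths. -/
def PathAlgebra (K V : Type u) [Field K] [Quiver.{u} V] : Type u :=
  QuiverPath V →₀ K

namespace PathAlgebra

variable {K V : Type u} [Field K] [Quiver.{u} V]

noncomputable instance : AddCommGroup (PathAlgebra K V) :=
  inferInstanceAs (AddCommGroup (QuiverPath V →₀ K))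

noncomputable instance : Module K (PathAlgebra K V) :=
  inferInstanceAs (Module K (QuiverPath V →₀ K))

/-- The basis element of the path algebra given by a path. -/
noncomputable def single (p : QuiverPath V) : PathAlgebra K V :=
  Finsupp.single p 1

/-- The path `p`, as an element of the path algebra. -/
noncomputable def ofPath (K : Type u) [Field K] {a b : V} (p : Quiver.Path a b) :
    PathAlgebra K V :=
  single ⟨a, b, p⟩

open Classical in
/-- The product `q p` of two paths, composed from right to left: it is "first `p`, then `q`" if `p`
ends where `q` starts, and `0` otherwise. -/
noncomputable def basisMul (q p : QuiverPath V) : PathAlgebra K V :=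
  if h : q.1 = p.2.1 then ofPath K (p.2.2.comp (q.2.2.cast h rfl)) else 0

/-- The bilinear extension of the product of paths. -/
noncomputable def mulHom :
    PathAlgebra K V →ₗ[K] PathAlgebra K V →ₗ[K] PathAlgebra K V :=
  Finsupp.linearCombination K fun q : QuiverPath V =>
    (Finsupp.linearCombination K fun p : QuiverPath V => basisMul q p :
      (QuiverPath V →₀ K) →ₗ[K] PathAlgebra K V)

noncomputable instance : Mul (PathAlgebra K V) := ⟨fun x y => mulHom x y⟩

/-- The unit element is the sum of all trivial paths. -/
noncomputable instance [Fintype V] : One (PathAlgebra K V) :=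
  ⟨∑ a : V, ofPath K (Quiver.Path.nil : Quiver.Path a a)⟩

theorem mul_def (x y : PathAlgebra K V) : x * y = mulHom x y := rfl

theorem single_mul_single (q p : QuiverPath V) :
    (single q * single p : PathAlgebra K V) = basisMul q p := by
  rw [mul_def]
  unfold mulHom single
  erw [Finsupp.linearCombination_single, one_smul, Finsupp.linearCombination_single, one_smul]

theorem ofPath_mul_ofPath {a b c : V} (q : Quiver.Path b c) (p : Quiver.Path a b) :
    ofPath K q * ofPath K p = ofPath K (p.comp q) := by
  unfold ofPath
  rw [single_mul_single]
  simp [basisMul, ofPath]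

theorem ofPath_mul_ofPath_of_ne {a b c d : V} (q : Quiver.Path c d) (p : Quiver.Path a b)
    (h : c ≠ b) : ofPath K q * ofPath K p = 0 := by
  unfold ofPath
  rw [single_mul_single]
  simp [basisMul, h]

@[elab_as_elim]
theorem induction_on {P : PathAlgebra K V → Prop} (x : PathAlgebra K V) (zero : P 0)
    (add : ∀ x y, P x → P y → P (x + y)) (smul : ∀ (c : K) x, P x → P (c • x))
    (path : ∀ (a b : V) (p : Quiver.Path a b), P (ofPath K p)) : P x := by
  refine Finsupp.induction_linear (motive := P) x zero add fun p c => ?_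
  have h : (Finsupp.single p c : QuiverPath V →₀ K) = c • (Finsupp.single p 1 : QuiverPath V →₀ K) :=
    by simp
  have h2 := smul c _ (path p.1 p.2.1 p.2.2)
  rw [h]
  exact h2

protected theorem add_mul' (x y z : PathAlgebra K V) : (x + y) * z = x * z + y * z := by
  simp [mul_def]

protected theorem mul_add' (x y z : PathAlgebra K V) : x * (y + z) = x * y + x * z := by
  simp [mul_def]

protected theorem smul_mul' (c : K) (x y : PathAlgebra K V) : (c • x) * y = c • (x * y) := by
  simp [mul_def]

protected theorem mul_smul' (c : K) (x y : PathAlgebra K V) : x * (c • y) = c • (x * y) := by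
  simp [mul_def]

protected theorem zero_mul' (x : PathAlgebra K V) : 0 * x = 0 := by
  simp [mul_def]

protected theorem mul_zero' (x : PathAlgebra K V) : x * 0 = 0 := by
  simp [mul_def]

protected theorem mul_assoc' (x y z : PathAlgebra K V) : x * y * z = x * (y * z) := by
  induction x using induction_on with
  | zero => simp only [PathAlgebra.zero_mul']
  | add x x' h h' => simp only [PathAlgebra.add_mul', h, h']
  | smul c x h => simp only [PathAlgebra.smul_mul', h]
  | path c d r =>
    induction y using induction_on with
    | zero => simp only [PathAlgebra.zero_mul', PathAlgebra.mul_zero']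
    | add x x' h h' => simp only [PathAlgebra.add_mul', PathAlgebra.mul_add', h, h']
    | smul c x h => simp only [PathAlgebra.smul_mul', PathAlgebra.mul_smul', h]
    | path b c' q =>
      induction z using induction_on with
      | zero => simp only [PathAlgebra.mul_zero']
      | add x x' h h' => simp only [PathAlgebra.mul_add', h, h']
      | smul c x h => simp only [PathAlgebra.mul_smul', h]
      | path a b' p =>
        by_cases h : c = c'
        · subst h
          by_cases h' : b = b'
          · subst h'
            simp only [ofPath_mul_ofPath, Quiver.Path.comp_assoc]
          · simp only [ofPath_mul_ofPath, ofPath_mul_ofPath_of_ne _ _ h', PathAlgebra.mul_zero']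
        · by_cases h' : b = b'
          · subst h'
            simp only [ofPath_mul_ofPath, ofPath_mul_ofPath_of_ne _ _ h, PathAlgebra.zero_mul']
          · simp only [ofPath_mul_ofPath_of_ne _ _ h, ofPath_mul_ofPath_of_ne _ _ h',
              PathAlgebra.zero_mul', PathAlgebra.mul_zero']

theorem one_def [Fintype V] :
    (1 : PathAlgebra K V) = ∑ a : V, ofPath K (Quiver.Path.nil : Quiver.Path a a) := rfl

protected theorem one_mul' [Fintype V] (x : PathAlgebra K V) : 1 * x = x := by
  induction x using induction_on with
  | zero => exact PathAlgebra.mul_zero' _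
  | add x x' h h' => rw [PathAlgebra.mul_add', h, h']
  | smul c x h => rw [PathAlgebra.mul_smul', h]
  | path a b p =>
    rw [one_def, mul_def, map_sum, LinearMap.sum_apply, Finset.sum_eq_single b]
    · rw [← mul_def, ofPath_mul_ofPath, Quiver.Path.comp_nil]
    · intro c _ hc
      rw [← mul_def, ofPath_mul_ofPath_of_ne _ _ hc]
    · intro h
      exact absurd (Finset.mem_univ b) h

protected theorem mul_one' [Fintype V] (x : PathAlgebra K V) : x * 1 = x := by
  induction x using induction_on with
  | zero => exact PathAlgebra.zero_mul' _
  | add x x' h h' => rw [PathAlgebra.add_mul', h, h']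
  | smul c x h => rw [PathAlgebra.smul_mul', h]
  | path a b p =>
    rw [one_def, mul_def, map_sum, Finset.sum_eq_single a]
    · rw [← mul_def, ofPath_mul_ofPath, Quiver.Path.nil_comp]
    · intro c _ hc
      rw [← mul_def, ofPath_mul_ofPath_of_ne _ _ hc.symm]
    · intro h
      exact absurd (Finset.mem_univ a) h

noncomputable instance [Fintype V] : Ring (PathAlgebra K V) :=
  { (inferInstance : AddCommGroup (PathAlgebra K V)) with
    mul := (· * ·)
    one := 1
    left_distrib := PathAlgebra.mul_add'
    right_distrib := PathAlgebra.add_mul'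
    zero_mul := PathAlgebra.zero_mul'
    mul_zero := PathAlgebra.mul_zero'
    mul_assoc := PathAlgebra.mul_assoc'
    one_mul := PathAlgebra.one_mul'
    mul_one := PathAlgebra.mul_one' }

noncomputable instance [Fintype V] : Algebra K (PathAlgebra K V) :=
  Algebra.ofModule PathAlgebra.smul_mul' PathAlgebra.mul_smul'

/-- The span of all paths of length at least `n`; this is the `n`-th power of the ideal generated by
the arrows. -/
noncomputable def lengthGE (K V : Type u) [Field K] [Quiver.{u} V] (n : ℕ) :
    Submodule K (PathAlgebra K V) :=
  Submodule.span K {x | ∃ (a b : V) (p : Quiver.Path a b), n ≤ p.length ∧ x = ofPath K p}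

/-- An ideal `I` is admissible if it lies between some power of the arrow ideal and the square of the
arrow ideal. -/
def IsAdmissible [Fintype V] (I : Ideal (PathAlgebra K V)) : Prop :=
  (∀ x ∈ I, x ∈ lengthGE K V 2) ∧ ∃ N : ℕ, ∀ x ∈ lengthGE K V N, x ∈ I

/-- The class of a path in the quotient `KΓ/I`. -/
noncomputable def pathClass [Fintype V] (I : Ideal (PathAlgebra K V)) [I.IsTwoSided] {a b : V}
    (p : Quiver.Path a b) : PathAlgebra K V ⧸ I :=
  Ideal.Quotient.mk I (ofPath K p)

end PathAlgebra

/-! ### Modules -/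

section Modules

variable (R : Type u) [Ring R]

/-- A module is uniserial if it has finite length and its submodules form a chain; equivalently, it
has exactly one composition series. -/
def IsUniserial (M : Type u) [AddCommGroup M] [Module R M] : Prop :=
  IsFiniteLength R M ∧ ∀ N N' : Submodule R M, N ≤ N' ∨ N' ≤ N

/-- A module is indecomposable if it is nonzero and not the direct sum of two nonzero submodules. -/
def IsIndecomposableModule (M : Type u) [AddCommGroup M] [Module R M] : Prop :=
  Nontrivial M ∧ ∀ N N' : Submodule R M, IsCompl N N' → N = ⊥ ∨ N' = ⊥

variable {R}

/-- A primitive idempotent: a nonzero idempotent that is not the sum of two nonzero orthogonal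
idempotents. -/
def IsPrimitiveIdempotent (e : R) : Prop :=
  IsIdempotentElem e ∧ e ≠ 0 ∧
    ∀ f g : R, IsIdempotentElem f → IsIdempotentElem g → f * g = 0 → g * f = 0 → e = f + g →
      f = 0 ∨ g = 0

variable (R)

/-- The left ideal `J e`, where `J` is the Jacobson radical of `R`. -/
noncomputable def radicalMul (e : R) : Submodule R R :=
  (Ring.jacobson R).map (LinearMap.toSpanSingleton R R e)

/-- A ring is left `m`-multiserial if, for each primitive idempotent `e`, the left ideal `J e` is the
(not necessarily direct) sum of `m` uniserial submodules, the zero module being allowed as a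
summand. -/
def IsLeftMultiserial (m : ℕ) : Prop :=
  ∀ e : R, IsPrimitiveIdempotent e →
    ∃ W : Fin m → Submodule R R, (∀ i, IsUniserial R (W i)) ∧ radicalMul R e = ⨆ i, W i

variable {R}

/-- A split monomorphism of modules. -/
def IsSplitMonoHom {A B : Type u} [AddCommGroup A] [Module R A] [AddCommGroup B] [Module R B]
    (f : A →ₗ[R] B) : Prop :=
  ∃ r : B →ₗ[R] A, r ∘ₗ f = LinearMap.id

/-- A split epimorphism of modules. -/
def IsSplitEpiHom {B C : Type u} [AddCommGroup B] [Module R B] [AddCommGroup C] [Module R C]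
    (g : B →ₗ[R] C) : Prop :=
  ∃ s : C →ₗ[R] B, g ∘ₗ s = LinearMap.id

/-- `f : A → B` is left almost split in the category of finitely generated modules: it is not a split
monomorphism, and every homomorphism from `A` to a finitely generated module that is not a split
monomorphism factors through `f`. -/
def IsLeftAlmostSplit {A B : Type u} [AddCommGroup A] [Module R A] [AddCommGroup B] [Module R B]
    (f : A →ₗ[R] B) : Prop :=
  ¬ IsSplitMonoHom f ∧
    ∀ (X : Type u) [AddCommGroup X] [Module R X] [Module.Finite R X] (h : A →ₗ[R] X),
      ¬ IsSplitMonoHom h → ∃ h' : B →ₗ[R] X, h' ∘ₗ f = h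

/-- `g : B → C` is right almost split in the category of finitely generated modules: it is not a split
epimorphism, and every homomorphism from a finitely generated module to `C` that is not a split
epimorphism factors through `g`. -/
def IsRightAlmostSplit {B C : Type u} [AddCommGroup B] [Module R B] [AddCommGroup C] [Module R C]
    (g : B →ₗ[R] C) : Prop :=
  ¬ IsSplitEpiHom g ∧
    ∀ (X : Type u) [AddCommGroup X] [Module R X] [Module.Finite R X] (h : X →ₗ[R] C),
      ¬ IsSplitEpiHom h → ∃ h' : X →ₗ[R] B, g ∘ₗ h' = h

/-- `0 → A → B → C → 0`, with maps `f` and `g`, is an almost split sequence. -/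
structure IsAlmostSplitSequence {A B C : Type u} [AddCommGroup A] [Module R A]
    [AddCommGroup B] [Module R B] [AddCommGroup C] [Module R C]
    (f : A →ₗ[R] B) (g : B →ₗ[R] C) : Prop where
  injective : Function.Injective f
  exact : Function.Exact f g
  surjective : Function.Surjective g
  leftAlmostSplit : IsLeftAlmostSplit f
  rightAlmostSplit : IsRightAlmostSplit g

variable (R)

/-- `M` is an (internal) direct sum of `n` indecomposable submodules. -/
def IsSumOfIndecomposables (M : Type u) [AddCommGroup M] [Module R M] (n : ℕ) : Prop :=
  ∃ N : Fin n → Submodule R M, DirectSum.IsInternal N ∧ ∀ i, IsIndecomposableModule R (N i)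

/-- There is an almost split sequence `0 → A → B → U → 0` of finitely generated modules whose middle
term `B` is a direct sum of `n` indecomposable modules. -/
def HasMiddleTermCount (U : Type u) [AddCommGroup U] [Module R U] (n : ℕ) : Prop :=
  ∃ (A B : ModuleCat.{u} R) (f : A →ₗ[R] B) (g : B →ₗ[R] U),
    Module.Finite R A ∧ Module.Finite R B ∧ IsAlmostSplitSequence f g ∧
      IsSumOfIndecomposables R B n

/-- `α(U) = n`: there is an almost split sequence ending in `U`, and `n` is the number of
indecomposable summands of the middle term, for every such sequence and every decomposition of its
middle term. -/
def AlphaEq (U : Type u) [AddCommGroup U] [Module R U] (n : ℕ) : Prop :=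
  HasMiddleTermCount R U n ∧ ∀ k : ℕ, HasMiddleTermCount R U k → k = n

/-- `α(U) ≤ n`. -/
def AlphaLE (U : Type u) [AddCommGroup U] [Module R U] (n : ℕ) : Prop :=
  ∃ k ≤ n, AlphaEq R U k

end Modules

/-- `p` is a mast of the module `U` over `KΓ/I`: its length is one less than the length of `U`, and
`p x ≠ 0` for some `x` in `U`. -/
def IsMast {K V : Type u} [Field K] [Quiver.{u} V] [Fintype V] (I : Ideal (PathAlgebra K V))
    [I.IsTwoSided] {a b : V} (p : Quiver.Path a b)
    (U : Type u) [AddCommGroup U] [Module (PathAlgebra K V ⧸ I) U] : Prop :=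
  Module.length (PathAlgebra K V ⧸ I) U = p.length + 1 ∧
    ∃ x : U, PathAlgebra.pathClass I p • x ≠ 0

/-! ### Almost split sequences ending in a local uniserial module -/

section AlmostSplit

variable {R : Type u} [Ring R]

/-! Write `R` for the algebra and `e v` for its vertex idempotents. A mast forces `U` to be
generated by some `x = e a • x`, so `U` is a quotient of `R e a`. Everything rests on the kernel
being cyclic, generated by one element `ω = e c * ω * e a` of the radical (`IsOneRelation`). Then
the transpose of `U` is the local right module `e c R / ω R`, and its dual `A`, the left end of the
almost split sequence, has a simple socle, spanned by the character `ε c`. The sequence is explicit: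
the middle term is `A × R e a` with `ε c` identified with `ω`
(`IsOneRelation.isAlmostSplitSequence`).

A simple socle bounds the number of summands of the middle term by two. Two complementary summands
cannot both map onto `U`: one of them would meet the kernel trivially, and then the inclusion of the
kernel would split (`not_map_eq_top_and_map_eq_top`). Two independent nonzero summands cannot both
map into the radical of `U`: their sum would embed into the uniserial module `U`
(`eq_bot_or_eq_bot_of_map_ne_top`). The count is two exactly when the inclusion of the radical of
`U` is irreducible (`eq_one_or_eq_two`). This condition does not mention the sequence, so the count
is well defined without the Krull-Schmidt theorem.

It remains to find `ω`. In (i) and (ii) the radical of `R e a` is uniserial, so its submodules are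
cyclic. In (iii) it is a sum of two uniserial modules, and `J p = 0` makes one relation between
their generators suffice (`exists_isOneRelation_of_sup`). Moreover `J p = 0` gives a factorization
of the inclusion of the radical of `U` in which neither map splits (`not_isIrreducibleInclusion`).
-/

theorem LinearMap.exists_comp_eq_of_surjective {B U X : Type*} [AddCommGroup B] [Module R B]
    [AddCommGroup U] [Module R U] [AddCommGroup X] [Module R X] (g : B →ₗ[R] U)
    (hg : Function.Surjective g) (d : B →ₗ[R] X) (h : ∀ b, g b = 0 → d b = 0) :
    ∃ θ : U →ₗ[R] X, θ ∘ₗ g = d := by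
  refine ⟨(LinearMap.ker g).liftQ d (fun b hb => h b hb) ∘ₗ
    (g.quotKerEquivOfSurjective hg).symm.toLinearMap, ?_⟩
  ext b
  have : (g.quotKerEquivOfSurjective hg).symm (g b) = (LinearMap.ker g).mkQ b := by
    rw [LinearEquiv.symm_apply_eq]
    rfl
  rw [LinearMap.comp_apply, LinearMap.comp_apply, LinearEquiv.coe_coe, this]
  exact Submodule.liftQ_apply _ _ _

variable {A B U : Type u} [AddCommGroup A] [Module R A] [AddCommGroup B] [Module R B]
  [AddCommGroup U] [Module R U] {f : A →ₗ[R] B} {g : B →ₗ[R] U}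

namespace IsAlmostSplitSequence

/-- The map `β` restricts to an endomorphism `φ` of `A`. If `φ` were not a split monomorphism, it
would extend along `f` to some `ψ`, and `β - f ∘ₗ ψ` would induce a section of `g`. This replaces
the minimality of almost split maps in all later arguments. -/
theorem injective_of_comp_eq [Module.Finite R A] (h : IsAlmostSplitSequence f g) {β : B →ₗ[R] B}
    (hβ : g ∘ₗ β = g) : Function.Injective β := by
  have hgβ : ∀ b, g (β b) = g b := fun b => LinearMap.congr_fun hβ b
  have hmem : ∀ a, β (f a) ∈ LinearMap.range f := fun a =>
    (h.exact _).1 (by rw [hgβ]; exact h.exact.apply_apply_eq_zero a)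
  let φ : A →ₗ[R] A := (LinearEquiv.ofInjective f h.injective).symm.toLinearMap ∘ₗ
    (β ∘ₗ f).codRestrict (LinearMap.range f) hmem
  have hφ : ∀ a, f (φ a) = β (f a) := fun a => by
    have := (LinearEquiv.ofInjective f h.injective).apply_symm_apply
      ((β ∘ₗ f).codRestrict (LinearMap.range f) hmem a)
    exact congrArg Subtype.val this
  have hsplit : IsSplitMonoHom φ := by
    by_contra hns
    obtain ⟨ψ, hψ⟩ := h.leftAlmostSplit.2 A φ hns
    obtain ⟨θ, hθ⟩ := LinearMap.exists_comp_eq_of_surjective g h.surjective (β - f ∘ₗ ψ) (by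
      intro b hb
      obtain ⟨a, rfl⟩ := (h.exact b).1 hb
      have : ψ (f a) = φ a := LinearMap.congr_fun hψ a
      simp [this, hφ])
    refine h.rightAlmostSplit.1 ⟨θ, ?_⟩
    ext y
    obtain ⟨b, rfl⟩ := h.surjective y
    have h1 : θ (g b) = β b - f (ψ b) := LinearMap.congr_fun hθ b
    simp [h1, hgβ, h.exact.apply_apply_eq_zero]
  obtain ⟨r, hr⟩ := hsplit
  rw [injective_iff_map_eq_zero]
  intro b hb
  obtain ⟨a, rfl⟩ := (h.exact b).1 (by rw [← hgβ, hb, map_zero])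
  have h0 : φ a = 0 := h.injective (by rw [hφ, hb, map_zero])
  have : r (φ a) = a := LinearMap.congr_fun hr a
  rw [← this, h0, map_zero, map_zero]

/-- The middle terms of two almost split sequences with the same end term embed into each other. -/
theorem exists_injective_comp_eq {A' B' : Type u} [AddCommGroup A'] [Module R A']
    [AddCommGroup B'] [Module R B'] {f' : A' →ₗ[R] B'} {g' : B' →ₗ[R] U}
    [Module.Finite R A'] [Module.Finite R B] [Module.Finite R B']
    (h : IsAlmostSplitSequence f g) (h' : IsAlmostSplitSequence f' g') :
    ∃ β : B' →ₗ[R] B, Function.Injective β ∧ g ∘ₗ β = g' := by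
  obtain ⟨β, hβ⟩ := h.rightAlmostSplit.2 B' g' h'.rightAlmostSplit.1
  obtain ⟨γ, hγ⟩ := h'.rightAlmostSplit.2 B g h.rightAlmostSplit.1
  refine ⟨β, ?_, hβ⟩
  have := h'.injective_of_comp_eq (β := γ ∘ₗ β) (by rw [← LinearMap.comp_assoc, hγ, hβ])
  exact Function.Injective.of_comp (f := γ) this

/-- If any two nonzero submodules of the kernel meet, then the middle term is not the direct sum of
two submodules that both map onto the end term. -/
theorem not_map_eq_top_and_map_eq_top (h : IsAlmostSplitSequence f g)
    (hker : ∀ K₁ K₂ : Submodule R B, K₁ ≤ LinearMap.ker g → K₂ ≤ LinearMap.ker g →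
      Disjoint K₁ K₂ → K₁ = ⊥ ∨ K₂ = ⊥)
    {N N' : Submodule R B} (hc : IsCompl N N') (hN : N.map g = ⊤) (hN' : N'.map g = ⊤) : False := by
  -- The intersections of `N` and `N'` with the kernel are disjoint, so one of them vanishes.
  wlog hK : N' ⊓ LinearMap.ker g = ⊥ generalizing N N'
  · refine this hc.symm hN' hN ?_
    exact (hker _ _ inf_le_right inf_le_right
      (hc.disjoint.mono inf_le_left inf_le_left)).resolve_right hK
  -- Injectivity holds because `N'` misses the kernel. For surjectivity, `n` is corrected by an
  -- element of `N'` so that the sum lies in the kernel. The inverse then yields a retraction of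
  -- `f`.
  have hproj : Function.Bijective (N.projectionOnto N' hc ∘ₗ f) := by
    constructor
    · rw [injective_iff_map_eq_zero]
      intro a ha
      have h1 : f a ∈ N' := (Submodule.projectionOnto_apply_eq_zero_iff hc).1 ha
      have h2 : f a ∈ N' ⊓ LinearMap.ker g := ⟨h1, h.exact.apply_apply_eq_zero a⟩
      rw [hK, Submodule.mem_bot] at h2
      exact h.injective (by rw [h2, map_zero])
    · intro n
      obtain ⟨n', hn', hgn'⟩ : -g n ∈ N'.map g := hN' ▸ Submodule.mem_top
      obtain ⟨a, ha⟩ := (h.exact (n + n')).1 (by rw [map_add, hgn', add_neg_cancel])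
      refine ⟨a, ?_⟩
      rw [LinearMap.comp_apply, ha, map_add, Submodule.projectionOnto_apply_left,
        (Submodule.projectionOnto_apply_eq_zero_iff hc).2 hn', add_zero]
  let E := LinearEquiv.ofBijective _ hproj
  refine h.leftAlmostSplit.1 ⟨E.symm.toLinearMap ∘ₗ N.projectionOnto N' hc, ?_⟩
  ext a
  exact E.symm_apply_apply a

end IsAlmostSplitSequence

/-- The inclusion of the nonzero submodule `M` into `U` is irreducible: if it factors through a
finitely generated module, then one of the factors splits. -/
def IsIrreducibleInclusion (M : Submodule R U) : Prop :=
  M ≠ ⊥ ∧ ∀ (Y : Type u) [AddCommGroup Y] [Module R Y] [Module.Finite R Y] (k : M →ₗ[R] Y)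
    (l : Y →ₗ[R] U), l ∘ₗ k = M.subtype → ¬ IsSplitEpiHom l → IsSplitMonoHom k

theorem Submodule.isIndecomposableModule_iff (N : Submodule R B) :
    IsIndecomposableModule R N ↔
      N ≠ ⊥ ∧ ∀ L L' : Submodule R B, Disjoint L L' → L ⊔ L' = N → L = ⊥ ∨ L' = ⊥ := by
  rw [IsIndecomposableModule, Submodule.nontrivial_iff_ne_bot]
  refine and_congr_right fun _ => ⟨fun h L L' hd hs => ?_, fun h L L' hc => ?_⟩
  · have hL : (L.comap N.subtype).map N.subtype = L := by
      rw [Submodule.map_comap_subtype, inf_eq_right, ← hs]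
      exact le_sup_left
    have hL' : (L'.comap N.subtype).map N.subtype = L' := by
      rw [Submodule.map_comap_subtype, inf_eq_right, ← hs]
      exact le_sup_right
    have hinj := Submodule.map_injective_of_injective N.injective_subtype
    have hc : IsCompl (L.comap N.subtype) (L'.comap N.subtype) := by
      constructor
      · rw [Submodule.disjoint_def] at hd ⊢
        exact fun x hx hx' => Subtype.ext (hd _ hx hx')
      · rw [codisjoint_iff]
        apply hinj
        rw [Submodule.map_sup, hL, hL', hs, Submodule.map_top, Submodule.range_subtype]
    rcases h _ _ hc with h0 | h0
    · exact Or.inl (by rw [← hL, h0, Submodule.map_bot])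
    · exact Or.inr (by rw [← hL', h0, Submodule.map_bot])
  · have hz : ∀ L : Submodule R N, L.map N.subtype = ⊥ → L = ⊥ := fun L hL =>
      Submodule.map_injective_of_injective N.injective_subtype (by rw [hL, Submodule.map_bot])
    refine (h (L.map N.subtype) (L'.map N.subtype) ?_ ?_).imp (hz L) (hz L')
    · exact Submodule.disjoint_map N.injective_subtype hc.disjoint
    · rw [← Submodule.map_sup, hc.sup_eq_top, Submodule.map_top, Submodule.range_subtype]

theorem Submodule.not_isSplitEpiHom_subtype {M : Submodule R U} (hM : M ≠ ⊤) :
    ¬ IsSplitEpiHom M.subtype := by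
  rintro ⟨s, hs⟩
  refine hM (eq_top_iff.2 fun y _ => ?_)
  rw [← show (s y : U) = y from LinearMap.congr_fun hs y]
  exact (s y).2

/-! ### Counting the indecomposable summands of the middle term -/

namespace IsAlmostSplitSequence

variable [IsNoetherian R U] [IsArtinian R B] [Module.Finite R A]
  {M : Submodule R U}

/-- A nonzero direct summand of the middle term that maps into the proper submodule `M` embeds into
it, and the inclusion of `M` is irreducible. -/
theorem disjoint_ker_and_isIrreducibleInclusion (hM : M ≠ ⊤)
    (hchain : ∀ N N' : Submodule R U, N ≤ N' ∨ N' ≤ N)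
    (h : IsAlmostSplitSequence f g)
    {N N' : Submodule R B} (hc : IsCompl N N') (hN0 : N ≠ ⊥) (hN : N.map g ≤ M) :
    Disjoint N (LinearMap.ker g) ∧ IsIrreducibleInclusion M := by
  let π := N.projectionOnto N' hc
  let κ : N →ₗ[R] M := (g ∘ₗ N.subtype).codRestrict M fun n => hN ⟨n, n.2, rfl⟩
  have key : ∀ l : M →ₗ[R] B, g ∘ₗ l = M.subtype →
      ∃ ρ : B →ₗ[R] N, ∀ n, ρ (l (κ n)) = n := by
    intro l hl
    have hl' : ∀ y, g (l y) = y := fun y => LinearMap.congr_fun hl y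
    -- This endomorphism lies over the identity of `U`, so it is bijective. On `N` it equals `l ∘ₗ
    -- κ`, so its inverse followed by `π` recovers `n` from `l (κ n)`.
    let β : B →ₗ[R] B := LinearMap.id - (N.subtype - l ∘ₗ κ) ∘ₗ π
    have hβ : Function.Injective β := h.injective_of_comp_eq (by
      ext b
      simp [β, hl', κ])
    let E := LinearEquiv.ofBijective β (IsArtinian.bijective_of_injective_endomorphism β hβ)
    refine ⟨π ∘ₗ E.symm.toLinearMap, fun n => ?_⟩
    have h1 : l (κ n) = E n := by
      simp [E, β, π]
    simp [h1, π]
  obtain ⟨l₀, hl₀⟩ := h.rightAlmostSplit.2 M M.subtype (Submodule.not_isSplitEpiHom_subtype hM)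
  have hκ : Function.Injective κ := by
    obtain ⟨ρ, hρ⟩ := key l₀ hl₀
    exact Function.LeftInverse.injective (g := fun y => ρ (l₀ y)) hρ
  refine ⟨?_, ?_, ?_⟩
  · rw [Submodule.disjoint_def]
    intro b hb hgb
    have : κ ⟨b, hb⟩ = 0 := Subtype.ext hgb
    exact congrArg Subtype.val (hκ (this.trans (map_zero κ).symm))
  · rintro rfl
    obtain ⟨n, hn, hn0⟩ := Submodule.exists_mem_ne_zero_of_ne_bot hN0
    have := @hκ ⟨n, hn⟩ 0 (Subsingleton.elim _ _)
    exact hn0 (congrArg Subtype.val this)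
  · intro Y _ _ _ k l hlk hl
    obtain ⟨m, hm⟩ := h.rightAlmostSplit.2 Y l hl
    obtain ⟨ρ, hρ⟩ := key (m ∘ₗ k) (by rw [← LinearMap.comp_assoc, hm, hlk])
    let σ : M →ₗ[R] N := ρ ∘ₗ m ∘ₗ k
    have hσ : ∀ n, σ (κ n) = n := hρ
    -- The kernel of `σ` meets the nonzero range of `κ` trivially, and submodules of `U` are
    -- comparable, so the kernel is zero. Hence `κ` and `σ` are mutually inverse.
    have hσinj : Function.Injective σ := by
      rw [injective_iff_map_eq_zero]
      intro y hy
      have hmem : ∀ y, y ∈ (LinearMap.ker σ).map M.subtype → y ∈ (LinearMap.range κ).map M.subtype →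
          y = 0 := by
        rintro _ ⟨y, hy, rfl⟩ ⟨z, ⟨n, rfl⟩, hz⟩
        obtain rfl : κ n = y := Subtype.ext hz
        have : n = 0 := (hσ n).symm.trans hy
        simp [this]
      rcases hchain ((LinearMap.ker σ).map M.subtype) ((LinearMap.range κ).map M.subtype) with h1 | h1
      · have h2 : (y : U) ∈ (LinearMap.ker σ).map M.subtype := ⟨y, hy, rfl⟩
        exact Subtype.ext (hmem _ h2 (h1 h2))
      · obtain ⟨n, hn, hn0⟩ := Submodule.exists_mem_ne_zero_of_ne_bot hN0
        have h2 : ((κ ⟨n, hn⟩ : M) : U) ∈ (LinearMap.range κ).map M.subtype := ⟨_, ⟨_, rfl⟩, rfl⟩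
        have h3 : κ ⟨n, hn⟩ = 0 := Subtype.ext (hmem _ (h1 h2) h2)
        exact absurd (congrArg Subtype.val (hκ (h3.trans (map_zero κ).symm))) hn0
    refine ⟨κ ∘ₗ ρ ∘ₗ m, ?_⟩
    ext y
    have : κ (σ y) = y := hσinj (hσ _)
    exact congrArg Subtype.val this

/-- The sum `N₁ ⊔ N₂` still maps into the largest proper submodule `M`, so `g` embeds it into `U`.
There all submodules are comparable, whereas `N₁` and `N₂` are disjoint. -/
theorem eq_bot_or_eq_bot_of_map_ne_top (hM : M ≠ ⊤)
    (hchain : ∀ N N' : Submodule R U, N ≤ N' ∨ N' ≤ N)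
    (hmax : ∀ N : Submodule R U, N ≠ ⊤ → N ≤ M)
    (h : IsAlmostSplitSequence f g)
    {N₁ N₂ N' : Submodule R B} (hd : Disjoint N₁ N₂) (hc : IsCompl (N₁ ⊔ N₂) N')
    (h₁ : N₁.map g ≠ ⊤) (h₂ : N₂.map g ≠ ⊤) : N₁ = ⊥ ∨ N₂ = ⊥ := by
  by_cases h0 : N₁ ⊔ N₂ = ⊥
  · exact Or.inl (eq_bot_iff.2 (le_sup_left.trans h0.le))
  have hdis := (h.disjoint_ker_and_isIrreducibleInclusion hM hchain hc h0
    (by rw [Submodule.map_sup]; exact sup_le (hmax _ h₁) (hmax _ h₂))).1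
  have aux : ∀ L L' : Submodule R B, L ≤ N₁ ⊔ N₂ → L' ≤ N₁ ⊔ N₂ → L.map g ≤ L'.map g → L ≤ L' := by
    intro L L' hL hL' hle b hb
    obtain ⟨b', hb', hbb'⟩ := hle ⟨b, hb, rfl⟩
    have : b - b' = 0 := Submodule.disjoint_def.1 hdis _ (sub_mem (hL hb) (hL' hb'))
      (by rw [LinearMap.mem_ker, map_sub, hbb', sub_self])
    rwa [sub_eq_zero.1 this]
  rcases hchain (N₁.map g) (N₂.map g) with hle | hle
  · exact Or.inl (hd.eq_bot_of_le (aux _ _ le_sup_left le_sup_right hle))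
  · exact Or.inr (hd.symm.eq_bot_of_le (aux _ _ le_sup_right le_sup_left hle))

/-- At most one summand maps onto `U` and at most one does not. If only one summand exists,
irreducibility would make `M` a direct summand of the indecomposable `B`; if there are two, one of
them maps into `M` and forces irreducibility. -/
theorem eq_one_or_eq_two (hM : M ≠ ⊤)
    (hchain : ∀ N N' : Submodule R U, N ≤ N' ∨ N' ≤ N)
    (hmax : ∀ N : Submodule R U, N ≠ ⊤ → N ≤ M)
    (hker : ∀ K₁ K₂ : Submodule R B, K₁ ≤ LinearMap.ker g → K₂ ≤ LinearMap.ker g →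
      Disjoint K₁ K₂ → K₁ = ⊥ ∨ K₂ = ⊥)
    [Module.Finite R B] (h : IsAlmostSplitSequence f g) {k : ℕ}
    (hk : IsSumOfIndecomposables R B k) :
    (k = 1 ∧ ¬ IsIrreducibleInclusion M) ∨ (k = 2 ∧ IsIrreducibleInclusion M) := by
  obtain ⟨N, hN, hind⟩ := hk
  rw [DirectSum.isInternal_submodule_iff_iSupIndep_and_iSup_eq_top] at hN
  obtain ⟨hindep, hsup⟩ := hN
  have hne : ∀ i, N i ≠ ⊥ := fun i => (Submodule.nontrivial_iff_ne_bot).1 (hind i).1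
  have hcompl : ∀ i, IsCompl (N i) (⨆ j ≠ i, N j) := fun i => by
    refine ⟨hindep i, codisjoint_iff.2 (eq_top_iff.2 ?_)⟩
    rw [← hsup]
    refine iSup_le fun j => ?_
    by_cases hj : j = i
    · exact hj ▸ le_sup_left
    · exact le_sup_of_le_right (le_iSup₂_of_le j hj le_rfl)
  -- The summands are indexed by the truth value of "maps onto `U`", which takes only two values.
  have hinj : Function.Injective fun i => (N i).map g = ⊤ := by
    intro i j hij
    by_contra hne'
    by_cases hi : (N i).map g = ⊤
    · have hj : (N j).map g = ⊤ := hij.mp hi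
      refine h.not_map_eq_top_and_map_eq_top hker (hcompl i) hi (eq_top_iff.2 (hj ▸ ?_))
      exact Submodule.map_mono (le_iSup₂_of_le j (Ne.symm hne') le_rfl)
    · have hj : (N j).map g ≠ ⊤ := fun hj => hi (hij.mpr hj)
      have hc : IsCompl (N i ⊔ N j) (⨆ l ∈ ({i, j}ᶜ : Set (Fin k)), N l) := by
        refine ⟨?_, codisjoint_iff.2 (eq_top_iff.2 ?_)⟩
        · have := hindep.disjoint_biSup_biSup (s := {i, j}) (t := ({i, j}ᶜ : Set (Fin k)))
            disjoint_compl_right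
          rwa [iSup_pair] at this
        · rw [← hsup]
          refine iSup_le fun l => ?_
          by_cases hl : l ∈ ({i, j} : Set (Fin k))
          · rcases hl with rfl | rfl
            · exact le_sup_of_le_left le_sup_left
            · exact le_sup_of_le_left le_sup_right
          · exact le_sup_of_le_right (le_iSup₂_of_le l hl le_rfl)
      rcases h.eq_bot_or_eq_bot_of_map_ne_top hM hchain hmax
        (hindep.pairwiseDisjoint hne') hc hi hj with h0 | h0
      · exact hne _ h0
      · exact hne _ h0
  have hle : k ≤ 2 := by
    have := Fintype.card_le_of_injective _ hinj
    simpa using this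
  have hgtop : (⊤ : Submodule R B).map g = ⊤ := by
    rw [Submodule.map_top, LinearMap.range_eq_top]
    exact h.surjective
  interval_cases k
  · exfalso
    rw [iSup_of_empty] at hsup
    rw [← hsup, Submodule.map_bot] at hgtop
    exact hM (eq_top_iff.2 (hgtop ▸ bot_le))
  · refine Or.inl ⟨rfl, fun hirr => ?_⟩
    have h0 : N 0 = ⊤ := by rw [← hsup]; exact (ciSup_unique (s := N)).symm
    obtain ⟨l, hl⟩ := h.rightAlmostSplit.2 M M.subtype (Submodule.not_isSplitEpiHom_subtype hM)
    obtain ⟨r, hr⟩ := hirr.2 B l g hl h.rightAlmostSplit.1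
    have hr' : ∀ y, r (l y) = y := fun y => LinearMap.congr_fun hr y
    have hB := ((N 0).isIndecomposableModule_iff.1 (hind 0)).2 (LinearMap.range l) (LinearMap.ker r)
      (by
        rw [Submodule.disjoint_def]
        rintro _ ⟨y, rfl⟩ hy
        rw [LinearMap.mem_ker, hr'] at hy
        rw [hy, map_zero])
      (by
        rw [h0, eq_top_iff]
        intro b _
        rw [← add_sub_cancel (l (r b)) b]
        exact Submodule.add_mem_sup ⟨_, rfl⟩ (by rw [LinearMap.mem_ker, map_sub, hr', sub_self]))
    rcases hB with h1 | h1
    · refine hirr.1 (eq_bot_iff.2 fun y hy => ?_)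
      have h2 : l ⟨y, hy⟩ = 0 := by
        rw [← Submodule.mem_bot R, ← h1]
        exact ⟨_, rfl⟩
      have h3 := hr' ⟨y, hy⟩
      rw [h2, map_zero] at h3
      exact (congrArg Subtype.val h3).symm
    · refine hM (eq_top_iff.2 fun y _ => ?_)
      obtain ⟨b, rfl⟩ := h.surjective y
      have h2 : l (r b) = b := by
        rw [LinearMap.ker_eq_bot] at h1
        exact h1 (hr' _)
      rw [← h2, show g (l (r b)) = r b from LinearMap.congr_fun hl _]
      exact (r b).2
  · refine Or.inr ⟨rfl, ?_⟩
    have : ∃ i, (N i).map g ≠ ⊤ := by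
      by_contra! hall
      exact absurd (hinj (a₁ := 0) (a₂ := 1) (by simp [hall])) (by decide)
    obtain ⟨i, hi⟩ := this
    exact (h.disjoint_ker_and_isIrreducibleInclusion hM hchain (hcompl i) (hne i) (hmax _ hi)).2

/-- Any nontrivial splitting of `B` already has indecomposable parts: refining it would give two
summands of the same kind, either both onto `U` or both inside `M`. -/
theorem exists_isSumOfIndecomposables (hM : M ≠ ⊤)
    (hchain : ∀ N N' : Submodule R U, N ≤ N' ∨ N' ≤ N)
    (hmax : ∀ N : Submodule R U, N ≠ ⊤ → N ≤ M)
    (hker : ∀ K₁ K₂ : Submodule R B, K₁ ≤ LinearMap.ker g → K₂ ≤ LinearMap.ker g →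
      Disjoint K₁ K₂ → K₁ = ⊥ ∨ K₂ = ⊥)
    (h : IsAlmostSplitSequence f g) :
    ∃ k, IsSumOfIndecomposables R B k := by
  have hgtop : (⊤ : Submodule R B).map g = ⊤ := by
    rw [Submodule.map_top, LinearMap.range_eq_top]
    exact h.surjective
  by_cases hB : ∀ L L' : Submodule R B, Disjoint L L' → L ⊔ L' = ⊤ → L = ⊥ ∨ L' = ⊥
  · refine ⟨1, fun _ => ⊤, ?_, fun _ => (Submodule.isIndecomposableModule_iff _).2 ⟨?_, hB⟩⟩
    · rw [DirectSum.isInternal_submodule_iff_iSupIndep_and_iSup_eq_top]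
      exact ⟨iSupIndep_subsingleton _, ciSup_const⟩
    · intro h0
      rw [show (⊤ : Submodule R B) = ⊥ from h0, Submodule.map_bot] at hgtop
      exact hM (eq_top_iff.2 (hgtop ▸ bot_le))
  push Not at hB
  obtain ⟨N, N', hd, hs, hN, hN'⟩ := hB
  have hc : IsCompl N N' := ⟨hd, codisjoint_iff.2 hs⟩
  clear hd hs
  wlog hns : N'.map g ≠ ⊤ generalizing N N'
  · refine this N' N hN' hN hc.symm fun hs => ?_
    exact h.not_map_eq_top_and_map_eq_top hker hc hs (not_not.1 hns)
  have hmapsup : ∀ L L' : Submodule R B, L.map g ≠ ⊤ → L'.map g ≠ ⊤ → (L ⊔ L').map g ≠ ⊤ := by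
    intro L L' hL hL' htop
    rw [Submodule.map_sup] at htop
    exact hM (eq_top_iff.2 (htop ▸ sup_le (hmax _ hL) (hmax _ hL')))
  have hsur : N.map g = ⊤ := by
    by_contra hN''
    exact hmapsup _ _ hN'' hns (hc.sup_eq_top ▸ hgtop)
  refine ⟨2, ![N, N'], ?_, ?_⟩
  · rw [DirectSum.isInternal_submodule_iff_isCompl (i := 0) (j := 1) _ (by decide)
      (by ext i; fin_cases i <;> simp)]
    exact hc
  have hindN' : IsIndecomposableModule R N' := by
    refine (Submodule.isIndecomposableModule_iff _).2 ⟨hN', fun L L' hd hs => ?_⟩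
    have hle : ∀ K ≤ N', K.map g ≠ ⊤ := fun K hK htop =>
      hns (eq_top_iff.2 (htop ▸ Submodule.map_mono hK))
    exact h.eq_bot_or_eq_bot_of_map_ne_top hM hchain hmax hd (hs ▸ hc.symm)
      (hle _ (hs ▸ le_sup_left)) (hle _ (hs ▸ le_sup_right))
  have hindN : IsIndecomposableModule R N := by
    refine (Submodule.isIndecomposableModule_iff _).2 ⟨hN, fun L L' hd hs => ?_⟩
    wlog hL : L.map g = ⊤ generalizing L L'
    · refine (this L' L hd.symm (by rw [sup_comm, hs]) ?_).symm
      by_contra hL'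
      exact hmapsup _ _ hL hL' (hs ▸ hsur)
    have hc' : IsCompl L (L' ⊔ N') := by
      refine ⟨?_, codisjoint_iff.2 (by rw [← sup_assoc, hs, hc.sup_eq_top])⟩
      refine Disjoint.disjoint_sup_right_of_disjoint_sup_left hd ?_
      rw [hs]
      exact hc.disjoint
    by_cases hL' : L'.map g = ⊤
    · exact (h.not_map_eq_top_and_map_eq_top hker hc' hL
        (eq_top_iff.2 (hL' ▸ Submodule.map_mono le_sup_left))).elim
    · refine Or.inr ((h.eq_bot_or_eq_bot_of_map_ne_top hM hchain hmax ?_ hc'.symm hL'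
        hns).resolve_right hN')
      exact hc.disjoint.mono_left (hs ▸ le_sup_right)
  intro i
  fin_cases i
  · exact hindN
  · exact hindN'

end IsAlmostSplitSequence

/-- The condition on the kernel passes to every other sequence ending in `U`, because the middle
terms embed into each other over `U`. -/
theorem alphaLE_two_and_alphaEq_one [IsArtinianRing R] [IsNoetherian R U]
    {M : Submodule R U} (hM : M ≠ ⊤) (hchain : ∀ N N' : Submodule R U, N ≤ N' ∨ N' ≤ N)
    (hmax : ∀ N : Submodule R U, N ≠ ⊤ → N ≤ M)
    [Module.Finite R A] [Module.Finite R B] (h : IsAlmostSplitSequence f g)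
    (hker : ∀ K₁ K₂ : Submodule R B, K₁ ≤ LinearMap.ker g → K₂ ≤ LinearMap.ker g →
      Disjoint K₁ K₂ → K₁ = ⊥ ∨ K₂ = ⊥) :
    AlphaLE R U 2 ∧ (¬ IsIrreducibleInclusion M → AlphaEq R U 1) := by
  have hall : ∀ k, HasMiddleTermCount R U k →
      (k = 1 ∧ ¬ IsIrreducibleInclusion M) ∨ (k = 2 ∧ IsIrreducibleInclusion M) := by
    rintro k ⟨A', B', f', g', hA', hB', h', hk⟩
    obtain ⟨β, hβ, hgβ⟩ := h.exists_injective_comp_eq h'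
    refine h'.eq_one_or_eq_two hM hchain hmax (fun K₁ K₂ h₁ h₂ hd => ?_) hk
    have hle : ∀ K : Submodule R B', K ≤ LinearMap.ker g' → K.map β ≤ LinearMap.ker g := by
      rintro K hK _ ⟨b, hb, rfl⟩
      exact (LinearMap.congr_fun hgβ b).trans (hK hb)
    have hz : ∀ K : Submodule R B', K.map β = ⊥ → K = ⊥ := fun K hK =>
      Submodule.map_injective_of_injective hβ (by rw [hK, Submodule.map_bot])
    exact (hker _ _ (hle _ h₁) (hle _ h₂) (Submodule.disjoint_map hβ hd)).imp (hz _) (hz _)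
  obtain ⟨k, hk⟩ := h.exists_isSumOfIndecomposables hM hchain hmax hker
  have hcount : HasMiddleTermCount R U k :=
    ⟨ModuleCat.of R A, ModuleCat.of R B, f, g, inferInstance, inferInstance, h, hk⟩
  have huniq : ∀ l, HasMiddleTermCount R U l → l = k := fun l hl => by
    rcases hall k hcount with ⟨hk, hi⟩ | ⟨hk, hi⟩ <;> rcases hall l hl with ⟨hl, hi'⟩ | ⟨hl, hi'⟩
    · rw [hk, hl]
    · exact absurd hi' hi
    · exact absurd hi hi'
    · rw [hk, hl]
  refine ⟨⟨k, ?_, hcount, huniq⟩, fun hirr => ?_⟩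
  · rcases hall k hcount with ⟨hk, -⟩ | ⟨hk, -⟩ <;> omega
  · obtain rfl : k = 1 := ((hall k hcount).resolve_right fun h => hirr h.2).1
    exact ⟨hcount, huniq⟩

end AlmostSplit

/-! ### Split basic algebras -/

/-- The idempotents `e v` and the characters `ε v` exhibit `R` as a split basic algebra: the
characters are dual to the idempotents, and the Jacobson radical is their common kernel, which
consists of nilpotent elements. -/
structure IsSplitBasic {K R V : Type u} [Field K] [Ring R] [Algebra K R] [Fintype V]
    (e : V → R) (ε : V → R →ₐ[K] K) : Prop where
  idem : ∀ v, e v * e v = e v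
  sum_eq_one : ∑ v, e v = 1
  apply_self : ∀ v, ε v (e v) = 1
  apply_of_ne : ∀ v w, v ≠ w → ε v (e w) = 0
  mem_jacobson : ∀ r, r ∈ Ring.jacobson R ↔ ∀ v, ε v r = 0
  nilpotent : ∀ r, (∀ v, ε v r = 0) → IsNilpotent r

namespace IsSplitBasic

variable {K R V : Type u} [Field K] [Ring R] [Algebra K R] [Fintype V]
  {e : V → R} {ε : V → R →ₐ[K] K}

theorem mul_mem_jacobson (hs : IsSplitBasic e ε)
    {r : R} {v : V} (h : ε v r = 0) : r * e v ∈ Ring.jacobson R := by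
  rw [hs.mem_jacobson]
  intro w
  by_cases hw : w = v
  · subst hw
    rw [map_mul, h, zero_mul]
  · rw [map_mul, hs.apply_of_ne w v hw, mul_zero]

theorem mul_sub_smul_mem_jacobson (hs : IsSplitBasic e ε)
    (r : R) (v : V) : r * e v - ε v r • e v ∈ Ring.jacobson R := by
  have : r * e v - ε v r • e v = (r - algebraMap K R (ε v r)) * e v := by
    rw [sub_mul, Algebra.smul_def]
  rw [this]
  exact hs.mul_mem_jacobson (by simp)

theorem isUnit_smul_add (hs : IsSplitBasic e ε)
    {c : K} (hc : c ≠ 0) {j : R} (hj : j ∈ Ring.jacobson R) :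
    IsUnit (algebraMap K R c + j) := by
  refine (hs.nilpotent j ((hs.mem_jacobson j).1 hj)).isUnit_add_left_of_commute
    ((IsUnit.mk0 c hc).map (algebraMap K R)) ?_
  exact (Algebra.commutes c j).symm

/-- On `e v`, left multiplication by `r` agrees with that by the scalar `ε v r` plus a radical
element, which is a unit. -/
theorem exists_mul_mul_eq (hs : IsSplitBasic e ε)
    {r : R} {v : V} (h : ε v r ≠ 0) : ∃ s, s * r * e v = e v := by
  obtain ⟨u, hu⟩ := hs.isUnit_smul_add h (hs.mul_sub_smul_mem_jacobson r v)
  refine ⟨↑u⁻¹, ?_⟩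
  have h1 : r * e v = u * e v := by
    rw [hu, add_mul, sub_mul, mul_assoc, hs.idem, smul_mul_assoc, hs.idem, ← Algebra.smul_def]
    abel
  rw [mul_assoc, h1, ← mul_assoc, Units.inv_mul, one_mul]

/-! ### Modules over a split basic algebra -/

section Modules

variable {N : Type*} [AddCommGroup N] [Module R N]

theorem exists_smul_notMem (hs : IsSplitBasic e ε)
    {P : Submodule R N} {x : N} (hx : x ∉ P) : ∃ v, e v • x ∉ P := by
  by_contra! h
  refine hx ?_
  rw [← one_smul R x, ← hs.sum_eq_one, Finset.sum_smul]
  exact sum_mem fun v _ => h v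

theorem eq_zero_of_smul_eq_zero (hs : IsSplitBasic e ε)
    {r : R} {v : V} {x : N} (hx : e v • x = x) (h : r • x = 0)
    (hr : ε v r ≠ 0) : x = 0 := by
  obtain ⟨s, hsr⟩ := hs.exists_mul_mul_eq hr
  rw [← hx, ← hsr, mul_smul, hx, mul_smul, h, smul_zero]

/-- If some `e w • y` lay outside `span {x}`, comparability would give `x = r • e w • y`. Then `x`
lies in the radical when `ε w r = 0`; otherwise `r` can be undone on `e w`, which puts `e w • y`
back into the span. -/
theorem span_eq_top_of_notMem (hs : IsSplitBasic e ε)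
    (hchain : ∀ P P' : Submodule R N, P ≤ P' ∨ P' ≤ P) {x : N}
    (hxJ : x ∉ Ring.jacobson R • (⊤ : Submodule R N)) :
    Submodule.span R {x} = ⊤ := by
  rw [eq_top_iff]
  intro y _
  by_contra hy
  obtain ⟨w, hw⟩ := hs.exists_smul_notMem hy
  rcases hchain (Submodule.span R {e w • y}) (Submodule.span R {x}) with h | h
  · exact hw (h (Submodule.mem_span_singleton_self _))
  obtain ⟨r, hr⟩ := Submodule.mem_span_singleton.1 (h (Submodule.mem_span_singleton_self x))
  by_cases hc : ε w r = 0
  · apply hxJ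
    rw [← hr, ← mul_smul]
    exact Submodule.smul_mem_smul (hs.mul_mem_jacobson hc) Submodule.mem_top
  · obtain ⟨s, hsr⟩ := hs.exists_mul_mul_eq hc
    apply hw
    rw [← hsr, mul_assoc, mul_smul, mul_smul, hr]
    exact Submodule.smul_mem _ _ (Submodule.mem_span_singleton_self x)

theorem le_jacobson_smul_top (hs : IsSplitBasic e ε)
    (hchain : ∀ P P' : Submodule R N, P ≤ P' ∨ P' ≤ P)
    {P : Submodule R N} (hP : P ≠ ⊤) : P ≤ Ring.jacobson R • (⊤ : Submodule R N) := by
  intro x hx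
  by_contra hxJ
  refine hP (eq_top_iff.2 ?_)
  rwa [← hs.span_eq_top_of_notMem hchain hxJ, Submodule.span_singleton_le_iff_mem]

/-- A submodule with totally ordered submodules is generated by an element supported at one
vertex. -/
theorem exists_eq_span (hs : IsSplitBasic e ε) [IsNoetherian R N] [Nonempty V] (P : Submodule R N)
    (hchain : ∀ Q Q' : Submodule R P, Q ≤ Q' ∨ Q' ≤ Q) :
    ∃ (v : V) (x : N), e v • x = x ∧ P = Submodule.span R {x} := by
  rcases subsingleton_or_nontrivial P with h | h
  · refine ⟨Classical.arbitrary V, 0, smul_zero _, ?_⟩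
    rw [Submodule.span_zero_singleton]
    exact Submodule.subsingleton_iff_eq_bot.1 h
  · obtain ⟨z, -, hz⟩ := SetLike.exists_of_lt (Submodule.jacobson_smul_lt_top (⊤ : Submodule R P))
    obtain ⟨v, hv⟩ := hs.exists_smul_notMem hz
    have hv' : e v • e v • z = e v • z := by rw [← mul_smul, hs.idem]
    refine ⟨v, (e v • z : P), congrArg Subtype.val hv', ?_⟩
    have := congrArg (Submodule.map P.subtype) (hs.span_eq_top_of_notMem hchain hv)
    rw [Submodule.map_top, Submodule.range_subtype, Submodule.map_span, Set.image_singleton] at this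
    exact this.symm

/-- The cyclic module on `x` is local: a multiple `r • x` with `ε v r ≠ 0` generates `x` again. -/
theorem exists_mem_jacobson_of_lt_span (hs : IsSplitBasic e ε)
    {P : Submodule R N} {v : V} {x : N} (hx : e v • x = x)
    (hxP : x ∉ P) {z : N} (hz : z ∈ P) (hzx : z ∈ Submodule.span R {x}) :
    ∃ j ∈ Ring.jacobson R, z = j • x := by
  obtain ⟨r, rfl⟩ := Submodule.mem_span_singleton.1 hzx
  by_cases hr : ε v r = 0
  · exact ⟨r * e v, hs.mul_mem_jacobson hr, by rw [mul_smul, hx]⟩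
  · obtain ⟨s, hsr⟩ := hs.exists_mul_mul_eq hr
    refine absurd ?_ hxP
    rw [← hx, ← hsr, mul_smul, hx, mul_smul]
    exact P.smul_mem _ hz

end Modules

/-- For orthogonal `f` and `g` with sum `e v`, one of `ε v f` and `ε v g` vanishes. That idempotent
is then killed by every character, so it is nilpotent and hence zero. -/
theorem isPrimitiveIdempotent (hs : IsSplitBasic e ε) (v : V) : IsPrimitiveIdempotent (e v) := by
  refine ⟨hs.idem v, fun h => ?_, fun f g hf hg hfg hgf hefg => ?_⟩
  · have := hs.apply_self v
    rw [h, map_zero] at this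
    exact zero_ne_one this
  · have key : ∀ f : R, IsIdempotentElem f → e v * f = f → ε v f = 0 → f = 0 := by
      intro f hf hef h0
      obtain ⟨n, hn⟩ := hs.nilpotent f (fun w => by
        by_cases hw : w = v
        · rw [hw, h0]
        · rw [← hef, map_mul, hs.apply_of_ne w v hw, zero_mul])
      rcases Nat.eq_zero_or_pos n with rfl | hn'
      · rw [pow_zero] at hn
        rw [← one_mul f, hn, zero_mul]
      · rwa [hf.pow_eq hn'.ne'] at hn
    have hef : e v * f = f := by rw [hefg, add_mul, hgf, hf.eq, add_zero]
    have heg : e v * g = g := by rw [hefg, add_mul, hfg, hg.eq, zero_add]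
    have h0 : ε v f * ε v g = 0 := by rw [← map_mul, hfg, map_zero]
    rcases mul_eq_zero.1 h0 with h0 | h0
    · exact Or.inl (key f hf hef h0)
    · exact Or.inr (key g hg heg h0)

end IsSplitBasic

/-! ### The almost split sequence ending in a module with one relation -/

/-- The `K`-dual of `R`, as a left `R`-module by `(r • a) y = a (y * r)`. -/
def DualModule (K R : Type u) [Field K] [Ring R] [Algebra K R] : Type u :=
  Module.Dual K R

namespace DualModule

variable {K R : Type u} [Field K] [Ring R] [Algebra K R]

noncomputable instance : AddCommGroup (DualModule K R) :=
  inferInstanceAs (AddCommGroup (Module.Dual K R))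

noncomputable instance : Module K (DualModule K R) :=
  inferInstanceAs (Module K (Module.Dual K R))

instance : FunLike (DualModule K R) R K :=
  inferInstanceAs (FunLike (Module.Dual K R) R K)

instance : LinearMapClass (DualModule K R) K R K :=
  inferInstanceAs (LinearMapClass (Module.Dual K R) K R K)

noncomputable instance : SMul R (DualModule K R) :=
  ⟨fun r a => (show Module.Dual K R from a) ∘ₗ LinearMap.mulRight K r⟩

@[ext]
theorem ext {a b : DualModule K R} (h : ∀ y, a y = b y) : a = b :=
  LinearMap.ext h

@[simp]
theorem smul_apply (r : R) (a : DualModule K R) (y : R) : (r • a) y = a (y * r) := rfl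

@[simp]
theorem add_apply (a b : DualModule K R) (y : R) : (a + b) y = a y + b y := rfl

@[simp]
theorem zero_apply (y : R) : (0 : DualModule K R) y = 0 := rfl

@[simp]
theorem field_smul_apply (c : K) (a : DualModule K R) (y : R) : (c • a) y = c * a y := rfl

noncomputable instance : Module R (DualModule K R) where
  one_smul a := by ext y; simp
  mul_smul r s a := by ext y; simp [mul_assoc]
  smul_zero r := by ext y; simp
  smul_add r a b := by ext y; simp
  add_smul r s a := by ext y; simp [mul_add]
  zero_smul a := by ext y; simp

instance : IsScalarTower K R (DualModule K R) where
  smul_assoc c r a := by ext y; simp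

instance [Module.Finite K R] : Module.Finite R (DualModule K R) :=
  haveI : Module.Finite K (DualModule K R) := inferInstanceAs (Module.Finite K (Module.Dual K R))
  Module.Finite.of_restrictScalars_finite K R (DualModule K R)

/-- The dual of the right module `f R / ω R`, where `f ω = ω`. -/
def transposeDual (K : Type u) [Field K] [Algebra K R] (f ω : R) : Submodule R (DualModule K R) where
  carrier := {a | ∀ y, a (f * y) = a y ∧ a (ω * y) = 0}
  add_mem' ha hb y := by simp [(ha y).1, (hb y).1, (ha y).2, (hb y).2]
  zero_mem' y := by simp
  smul_mem' r a ha y := by simp [mul_assoc, (ha (y * r)).1, (ha (y * r)).2]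

variable {f ω : R}

theorem transposeDual_apply (a : transposeDual K f ω) (y : R) : a.1 (f * y) = a.1 y := (a.2 y).1

theorem transposeDual_apply_rel (a : transposeDual K f ω) (y : R) : a.1 (ω * y) = 0 := (a.2 y).2

/-- A functional that vanishes on `ω E` induces a homomorphism from `E` to the dual of
`f R / ω R`. -/
def homOfFunctional (hf : f * f = f) (hω : f * ω = ω) {E : Type*} [AddCommGroup E] [Module R E]
    [Module K E] [IsScalarTower K R E] (φ : E →ₗ[K] K) (hφ : ∀ q, φ (ω • q) = 0) :
    E →ₗ[R] transposeDual K f ω where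
  toFun q := ⟨(φ ∘ₗ (LinearMap.toSpanSingleton R E q).restrictScalars K ∘ₗ LinearMap.mulLeft K f :
      Module.Dual K R), fun y => by
    constructor
    · change φ ((f * (f * y)) • q) = φ ((f * y) • q)
      rw [← mul_assoc, hf]
    · change φ ((f * (ω * y)) • q) = 0
      rw [← mul_assoc, hω, mul_smul, hφ]⟩
  map_add' q q' := by
    ext y
    change φ ((f * y) • (q + q')) = φ ((f * y) • q) + φ ((f * y) • q')
    rw [smul_add, map_add]
  map_smul' r q := by
    ext y
    change φ ((f * y) • r • q) = φ ((f * (y * r)) • q)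
    rw [← mul_smul, mul_assoc]

section Extension

variable {E : Type*} [AddCommGroup E] [Module R E] [Module K E] [IsScalarTower K R E]

/-- A criterion for a homomorphism from the dual of `f R / ω R` to be a split monomorphism. -/
theorem exists_leftInverse_of_forall (hf : f * f = f) (hω : f * ω = ω)
    (ι : transposeDual K f ω →ₗ[R] E)
    (h : ∀ (q : E) (a : transposeDual K f ω), ω • q = ι a → a.1 1 = 0) :
    ∃ ρ : E →ₗ[R] transposeDual K f ω, ρ ∘ₗ ι = LinearMap.id := by
  let S : Submodule K E := LinearMap.range (Algebra.lsmul K K E ω)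
  let ιK : transposeDual K f ω →ₗ[K] E ⧸ S := S.mkQ ∘ₗ ι.restrictScalars K
  let ev : Module.Dual K (transposeDual K f ω) :=
    { toFun := fun a => a.1 1, map_add' := fun a b => rfl, map_smul' := fun c a => rfl }
  -- Homomorphisms from `E` to the dual arise from functionals on `E / ω E`. Evaluation at `1`,
  -- which would come from the identity, vanishes on the kernel of the map into this quotient and
  -- therefore extends.
  have hev : ev ∈ (LinearMap.ker ιK).dualAnnihilator := by
    rw [Submodule.mem_dualAnnihilator]
    intro a ha
    obtain ⟨q, hq⟩ := (Submodule.Quotient.mk_eq_zero S).1 ha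
    exact h q a hq
  rw [← LinearMap.range_dualMap_eq_dualAnnihilator_ker] at hev
  obtain ⟨φ, hφ⟩ := hev
  have hφS : ∀ q : E, (φ ∘ₗ S.mkQ) (ω • q) = 0 := fun q => by
    have : S.mkQ (ω • q) = 0 := (Submodule.Quotient.mk_eq_zero S).2 ⟨q, rfl⟩
    rw [LinearMap.comp_apply, this, map_zero]
  refine ⟨homOfFunctional hf hω (φ ∘ₗ S.mkQ) hφS, ?_⟩
  ext a y
  change φ (S.mkQ ((f * y) • ι a)) = a.1 y
  rw [← map_smul]
  have h1 : φ (S.mkQ (ι ((f * y) • a))) = ((f * y) • a).1 1 := LinearMap.congr_fun hφ ((f * y) • a)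
  rw [h1, Submodule.coe_smul, smul_apply, one_mul, transposeDual_apply]

theorem exists_hom_apply_ne_zero (hf : f * f = f) (hω : f * ω = ω) {z : E} (hz : f • z = z)
    (h : ∀ q : E, ω • q ≠ z) : ∃ ρ : E →ₗ[R] transposeDual K f ω, ρ z ≠ 0 := by
  have hz' : z ∉ LinearMap.range (Algebra.lsmul K K E ω) := by
    rintro ⟨q, hq⟩
    exact h q hq
  obtain ⟨φ, hφz, hφ⟩ := Submodule.exists_le_ker_of_notMem hz'
  refine ⟨homOfFunctional hf hω φ fun q => hφ ⟨q, rfl⟩, fun h0 => hφz ?_⟩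
  have h1 : φ ((f * 1) • z) = 0 := congrArg (fun a : transposeDual K f ω => a.1 1) h0
  rwa [mul_one, hz] at h1

end Extension

end DualModule

/-- The element `x` generates `U`, is supported at the vertex `a`, and its relations are generated by
the nonzero element `ω` of the radical, which is supported at `c` and `a`. -/
structure IsOneRelation {R V : Type u} [Ring R]
    (e : V → R) (a c : V) (ω : R) {U : Type u} [AddCommGroup U] [Module R U] (x : U) : Prop where
  smul_self : e a • x = x
  span_eq_top : Submodule.span R {x} = ⊤
  rel_smul : ω • x = 0
  left_mul : e c * ω = ω
  mul_right : ω * e a = ω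
  ne_zero : ω ≠ 0
  mem_jacobson : ω ∈ Ring.jacobson R
  mem_span : ∀ r : R, r • x = 0 → r * e a ∈ Submodule.span R {ω}

namespace IsOneRelation

open DualModule

variable {K R V : Type u} [Field K] [Ring R] [Algebra K R]
  {e : V → R} {ε : V → R →ₐ[K] K} {a c : V} {ω : R}
  {U : Type u} [AddCommGroup U] [Module R U] {x : U}

theorem exists_smul_eq (h : IsOneRelation e a c ω x) (y : U) : ∃ r : R, r • x = y :=
  Submodule.mem_span_singleton.1 (h.span_eq_top ▸ Submodule.mem_top)

theorem apply_eq_zero_of_mul_eq_zero [Fintype V] (hs : IsSplitBasic e ε)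
    (h : IsOneRelation e a c ω x) {r : R}
    (hr : r * ω = 0) : ε c r = 0 := by
  by_contra hc
  exact h.ne_zero (hs.eq_zero_of_smul_eq_zero (N := R) h.left_mul hr hc)

/-- A homomorphism is determined by the image of the generator, which may be any element that
satisfies the relation. -/
theorem exists_hom (h : IsOneRelation e a c ω x) {X : Type*} [AddCommGroup X] [Module R X] {q : X}
    (hq : ω • q = 0) : ∃ σ : U →ₗ[R] X, σ x = e a • q := by
  obtain ⟨σ, hσ⟩ := LinearMap.exists_comp_eq_of_surjective (LinearMap.toSpanSingleton R U x)
    h.exists_smul_eq (LinearMap.toSpanSingleton R X (e a • q)) (by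
      intro r hr
      obtain ⟨s, hsr⟩ := Submodule.mem_span_singleton.1 (h.mem_span r hr)
      rw [LinearMap.toSpanSingleton_apply, ← mul_smul, ← hsr, smul_eq_mul, mul_smul, hq, smul_zero])
  refine ⟨σ, ?_⟩
  simpa using LinearMap.congr_fun hσ 1

/-- The generator of the socle of the dual of the transpose. -/
noncomputable def socleElement [Fintype V] (hs : IsSplitBasic e ε) (h : IsOneRelation e a c ω x) :
    transposeDual K (e c) ω :=
  ⟨((ε c).toLinearMap : Module.Dual K R), fun y => by
    change ε c (e c * y) = ε c y ∧ ε c (ω * y) = 0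
    rw [map_mul, map_mul, hs.apply_self, one_mul, (hs.mem_jacobson ω).1 h.mem_jacobson, zero_mul]
    exact ⟨rfl, rfl⟩⟩

/-! ### The explicit sequence and its almost split property -/

section

variable [Fintype V] (hs : IsSplitBasic e ε) (h : IsOneRelation e a c ω x)

theorem smul_socleElement_apply (r y : R) :
    (r • h.socleElement hs).1 y = ε c y * ε c r := map_mul (ε c) y r

theorem socleElement_apply_one : (h.socleElement hs).1 1 = 1 := map_one (ε c)

/-- A simple submodule is killed by the radical, so its functionals vanish on the radical. Being
determined on `e c R`, they are scalar multiples of `ε c`. -/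
theorem socleElement_mem [Module.Finite K R] {M : Submodule R (transposeDual K (e c) ω)}
    (hM : M ≠ ⊥) : h.socleElement hs ∈ M := by
  have := IsArtinianRing.of_finite K R
  obtain ⟨T, hT, hTM⟩ := (IsAtomic.eq_bot_or_exists_atom_le M).resolve_left hM
  apply hTM
  have hJT : Ring.jacobson R • T = ⊥ :=
    hT.2 _ (Submodule.FG.jacobson_smul_lt hT.1 (IsNoetherian.noetherian T))
  obtain ⟨b, hb, hb0⟩ := Submodule.exists_mem_ne_zero_of_ne_bot hT.1
  have hj : ∀ j ∈ Ring.jacobson R, b.1 j = 0 := fun j hj => by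
    have h1 : j • b = 0 := by
      rw [← Submodule.mem_bot R, ← hJT]
      exact Submodule.smul_mem_smul hj hb
    have h2 : b.1 (1 * j) = 0 := congrArg (fun a : transposeDual K (e c) ω => a.1 1) h1
    rwa [one_mul] at h2
  have hby : ∀ y, b.1 y = ε c y * b.1 1 := fun y => by
    have h1 : e c * y - ε c y • e c ∈ Ring.jacobson R := by
      rw [hs.mem_jacobson]
      intro w
      by_cases hw : w = c
      · subst hw
        simp [hs.apply_self]
      · simp [hs.apply_of_ne w c hw]
    have h2 := hj _ h1
    rw [map_sub, map_smul, transposeDual_apply, sub_eq_zero, smul_eq_mul] at h2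
    rw [h2, ← transposeDual_apply b 1, mul_one]
  have hb1 : b.1 1 ≠ 0 := fun h0 => hb0 (by
    ext y
    rw [hby, h0, mul_zero]
    rfl)
  have : h.socleElement hs = algebraMap K R (b.1 1)⁻¹ • b := by
    ext y
    rw [algebraMap_smul]
    change ε c y = (b.1 1)⁻¹ * b.1 y
    rw [hby y, mul_left_comm, inv_mul_cancel₀ hb1, mul_one]
  rw [this]
  exact T.smul_mem _ hb

/-- The relations that define the middle term. -/
noncomputable def middleRelations : Submodule R (transposeDual K (e c) ω × R) :=
  Submodule.span R {(h.socleElement hs, -ω), (0, 1 - e a)}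

/-- The middle term of the almost split sequence. -/
abbrev Middle : Type u := (transposeDual K (e c) ω × R) ⧸ h.middleRelations hs

/-- Right multiplication by `e a` kills the second generator and fixes `ω`. -/
theorem mem_middleRelations {z : transposeDual K (e c) ω × R} (hz : z ∈ h.middleRelations hs) :
    ∃ r : R, z.1 = r • h.socleElement hs ∧ z.2 * e a = -(r * ω) := by
  obtain ⟨r, s, rfl⟩ := Submodule.mem_span_pair.1 hz
  refine ⟨r, by simp, ?_⟩
  simp [add_mul, mul_assoc, sub_mul, hs.idem, h.mul_right]

/-- The inclusion of the kernel into the middle term. -/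
noncomputable def inclusion : transposeDual K (e c) ω →ₗ[R] h.Middle hs :=
  (h.middleRelations hs).mkQ ∘ₗ LinearMap.inl R _ _

/-- The projection from the middle term. -/
noncomputable def projection : h.Middle hs →ₗ[R] U :=
  (h.middleRelations hs).liftQ (LinearMap.toSpanSingleton R U x ∘ₗ LinearMap.snd R _ _) (by
    rw [middleRelations, Submodule.span_le]
    rintro _ (rfl | rfl)
    · simp [h.rel_smul]
    · simp [sub_smul, h.smul_self])

theorem inclusion_apply (b : transposeDual K (e c) ω) :
    h.inclusion hs b = (h.middleRelations hs).mkQ (b, 0) := rfl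

theorem projection_apply (z : transposeDual K (e c) ω × R) :
    h.projection hs ((h.middleRelations hs).mkQ z) = z.2 • x := rfl

theorem injective_inclusion : Function.Injective (h.inclusion hs) := by
  rw [injective_iff_map_eq_zero]
  intro b hb
  obtain ⟨r, hr, hr'⟩ := h.mem_middleRelations hs ((Submodule.Quotient.mk_eq_zero _).1 hb)
  have h0 : ε c r = 0 := h.apply_eq_zero_of_mul_eq_zero hs (by simpa using hr'.symm)
  ext y
  rw [show b = r • h.socleElement hs from hr, h.smul_socleElement_apply, h0, mul_zero]
  rfl

theorem surjective_projection : Function.Surjective (h.projection hs) := fun y => by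
  obtain ⟨r, rfl⟩ := h.exists_smul_eq y
  exact ⟨(h.middleRelations hs).mkQ (0, r), rfl⟩

theorem mkQ_rel_eq : (h.middleRelations hs).mkQ (0, ω) = h.inclusion hs (h.socleElement hs) := by
  rw [inclusion_apply, ← sub_eq_zero, ← map_sub]
  refine (Submodule.Quotient.mk_eq_zero _).2 ?_
  have : ((0, ω) : transposeDual K (e c) ω × R) - (h.socleElement hs, 0) =
      -(h.socleElement hs, -ω) := by simp
  rw [this]
  exact neg_mem (Submodule.subset_span (by simp))

theorem mkQ_one_sub_eq : (h.middleRelations hs).mkQ (0, 1 - e a) = 0 :=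
  (Submodule.Quotient.mk_eq_zero _).2 (Submodule.subset_span (by simp))

theorem mkQ_eq (z : transposeDual K (e c) ω × R) : (h.middleRelations hs).mkQ z =
    h.inclusion hs z.1 + z.2 • (h.middleRelations hs).mkQ (0, 1) := by
  rw [inclusion_apply, ← map_smul, ← map_add]
  simp

theorem smul_mkQ_one : e a • (h.middleRelations hs).mkQ (0, 1) = (h.middleRelations hs).mkQ (0, 1) := by
  have h1 : ((0, 1) : transposeDual K (e c) ω × R) = e a • (0, 1) + (0, 1 - e a) := by simp
  conv_rhs => rw [h1, map_add, h.mkQ_one_sub_eq hs, add_zero, map_smul]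

theorem rel_smul_mkQ_one :
    ω • (h.middleRelations hs).mkQ (0, 1) = h.inclusion hs (h.socleElement hs) := by
  rw [← h.mkQ_rel_eq hs, ← map_smul]
  simp

theorem exact_inclusion_projection : Function.Exact (h.inclusion hs) (h.projection hs) := by
  intro b
  constructor
  · intro hb
    obtain ⟨z, rfl⟩ := (h.middleRelations hs).mkQ_surjective b
    rw [projection_apply] at hb
    obtain ⟨s, hsr⟩ := Submodule.mem_span_singleton.1 (h.mem_span _ hb)
    refine ⟨z.1 + s • h.socleElement hs, ?_⟩
    rw [h.mkQ_eq hs z, ← h.smul_mkQ_one hs, ← mul_smul, ← hsr, map_add, map_smul, smul_eq_mul,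
      mul_smul, h.rel_smul_mkQ_one hs]
  · rintro ⟨b, rfl⟩
    rw [inclusion_apply, projection_apply, zero_smul]

/-- In the middle term the socle generator is a multiple of `ω`, but inside the dual every multiple
of `ω` vanishes at `1`. -/
theorem not_isSplitMonoHom_inclusion : ¬ IsSplitMonoHom (h.inclusion hs) := by
  rintro ⟨ρ, hρ⟩
  have h1 : ω • ρ ((h.middleRelations hs).mkQ (0, 1)) = h.socleElement hs := by
    rw [← map_smul, h.rel_smul_mkQ_one hs]
    exact LinearMap.congr_fun hρ _
  have h2 := h.socleElement_apply_one hs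
  rw [← h1] at h2
  have h3 := transposeDual_apply_rel (ρ ((h.middleRelations hs).mkQ (0, 1))) 1
  rw [mul_one] at h3
  rw [Submodule.coe_smul, DualModule.smul_apply, one_mul, h3] at h2
  exact zero_ne_one h2

theorem not_isSplitEpiHom_projection : ¬ IsSplitEpiHom (h.projection hs) := fun hsplit =>
  h.not_isSplitMonoHom_inclusion hs
    ((((h.exact_inclusion_projection hs).split_tfae (h.injective_inclusion hs)
      (h.surjective_projection hs)).out 0 1).1 hsplit)

/-- If `k` sends the socle generator into `ω X`, it extends by choosing the image of the class of
`(0, 1)`. Otherwise a functional vanishing on `ω X` gives a map back to the dual that is nonzero on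
the socle. The composite is injective, hence bijective, and `k` splits. -/
theorem isLeftAlmostSplit_inclusion [Module.Finite K R] : IsLeftAlmostSplit (h.inclusion hs) := by
  have := IsArtinianRing.of_finite K R
  refine ⟨h.not_isSplitMonoHom_inclusion hs, fun X _ _ _ k hk => ?_⟩
  obtain ⟨q, hq⟩ : ∃ q : X, ω • q = k (h.socleElement hs) := by
    by_contra! hq
    apply hk
    let : Module K X := Module.compHom X (algebraMap K R)
    have : IsScalarTower K R X := ⟨fun c r q => by rw [Algebra.smul_def, mul_smul]; rfl⟩
    obtain ⟨ρ, hρ⟩ := exists_hom_apply_ne_zero (K := K) (hs.idem c) h.left_mul (by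
      rw [← map_smul]
      congr 1
      ext y
      rw [h.smul_socleElement_apply, hs.apply_self, mul_one]
      rfl) hq
    have hinj : Function.Injective (ρ ∘ₗ k) := by
      rw [← LinearMap.ker_eq_bot]
      by_contra hker
      exact hρ (h.socleElement_mem hs hker)
    let E := LinearEquiv.ofBijective _ (IsArtinian.bijective_of_injective_endomorphism _ hinj)
    refine ⟨E.symm.toLinearMap ∘ₗ ρ, ?_⟩
    ext1 b
    exact E.symm_apply_apply b
  refine ⟨(h.middleRelations hs).liftQ
    (k.coprod (LinearMap.toSpanSingleton R X (e a • q))) ?_, ?_⟩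
  · rw [middleRelations, Submodule.span_le]
    rintro _ (rfl | rfl)
    · simp [← hq, ← mul_smul, h.mul_right]
    · simp [← mul_smul, sub_mul, hs.idem]
  · ext b
    rw [LinearMap.comp_apply, inclusion_apply, Submodule.mkQ_apply, Submodule.liftQ_apply]
    simp

/-- If the middle term has an element over `k q` whose multiple by the relation has a nonzero
component in the socle, while the relation annihilates `q`, then `k` splits. -/
theorem apply_eq_zero_of_not_isSplitEpiHom (hs : IsSplitBasic e ε)
    (h : IsOneRelation e a c ω x)
    [IsNoetherian R U] {X : Type u} [AddCommGroup X]
    [Module R X] {k : X →ₗ[R] U} (hk : ¬ IsSplitEpiHom k) {q : X} (hq : ω • q = 0) {r l : R}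
    (hr : r • x = k q) (hl : ω * r * e a = -(l * ω)) : ε c l = 0 := by
  -- If `ε a r = 0`, then `e a * r * e a` is nilpotent, and moving its powers across `ω` turns them
  -- into powers of `-l`. Otherwise `x ↦ e a • q` defines a map whose composite with `k` is a
  -- surjective endomorphism of `U`, so `k` would split.
  by_cases har : ε a r = 0
  · obtain ⟨n, hn⟩ := hs.nilpotent (e a * r * e a) fun v => by
      by_cases hv : v = a
      · subst hv
        rw [map_mul, map_mul, har, mul_zero, zero_mul]
      · rw [map_mul, hs.apply_of_ne v a hv, mul_zero]
    have hpow : ∀ n : ℕ, ω * (e a * r * e a) ^ n = (-l) ^ n * ω := by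
      intro n
      induction n with
      | zero => rw [pow_zero, pow_zero, mul_one, one_mul]
      | succ n ih =>
        rw [pow_succ, ← mul_assoc, ih, mul_assoc, ← mul_assoc ω, ← mul_assoc ω, h.mul_right, hl,
          pow_succ, mul_assoc, neg_mul]
    have h0 := h.apply_eq_zero_of_mul_eq_zero hs ((hpow n).symm.trans (by rw [hn, mul_zero]))
    rw [map_pow, map_neg] at h0
    exact neg_eq_zero.1 (eq_zero_of_pow_eq_zero h0)
  · exfalso
    obtain ⟨σ, hσ⟩ := h.exists_hom hq
    obtain ⟨s, hsr⟩ := hs.exists_mul_mul_eq (r := e a * r) (v := a)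
      (by rwa [map_mul, hs.apply_self, one_mul])
    have hsur : Function.Surjective (k ∘ₗ σ) := fun y => by
      obtain ⟨t, rfl⟩ := h.exists_smul_eq y
      refine ⟨(t * s) • x, ?_⟩
      have hx : (s * (e a * r) * e a) • x = x := by rw [hsr, h.smul_self]
      simp only [mul_smul, h.smul_self] at hx
      rw [map_smul, LinearMap.comp_apply, hσ, map_smul, ← hr, mul_smul, hx]
    let F := LinearEquiv.ofBijective _ (IsNoetherian.bijective_of_surjective_endomorphism _ hsur)
    refine hk ⟨σ ∘ₗ F.symm.toLinearMap, ?_⟩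
    ext1 y
    exact F.apply_symm_apply y

/-- The pullback `E` of the sequence along `k` splits by `exists_leftInverse_of_forall`, whose
criterion reduces to the vanishing of `ε c l`. The splitting gives the lift of `k`. -/
theorem isRightAlmostSplit_projection [Module.Finite K R] [IsNoetherian R U] :
    IsRightAlmostSplit (h.projection hs) := by
  refine ⟨h.not_isSplitEpiHom_projection hs, fun X _ _ _ k hk => ?_⟩
  let : Module K X := Module.compHom X (algebraMap K R)
  have : IsScalarTower K R X := ⟨fun c r q => by rw [Algebra.smul_def, mul_smul]; rfl⟩
  let E : Submodule R (h.Middle hs × X) :=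
    LinearMap.ker ((h.projection hs).coprod (-k))
  have hE : ∀ z : E, h.projection hs z.1.1 = k z.1.2 := fun z => by
    have := z.2
    rw [LinearMap.mem_ker, LinearMap.coprod_apply, LinearMap.neg_apply, ← sub_eq_add_neg,
      sub_eq_zero] at this
    exact this
  let ι : transposeDual K (e c) ω →ₗ[R] E :=
    (LinearMap.inl R _ _ ∘ₗ h.inclusion hs).codRestrict E fun b => by
      simp [E, (h.exact_inclusion_projection hs).apply_apply_eq_zero]
  obtain ⟨ρ, hρ⟩ := exists_leftInverse_of_forall (K := K) (hs.idem c) h.left_mul ι (by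
    intro z b hz
    have hz1 : ω • z.1.1 = h.inclusion hs b := congrArg (fun z : E => z.1.1) hz
    have hz2 : ω • z.1.2 = 0 := congrArg (fun z : E => z.1.2) hz
    have hz3 := hE z
    generalize z.1.1 = b₁ at *
    generalize z.1.2 = q at *
    obtain ⟨⟨b', r⟩, rfl⟩ := (h.middleRelations hs).mkQ_surjective b₁
    rw [projection_apply] at hz3
    rw [inclusion_apply, ← map_smul, ← sub_eq_zero, ← map_sub] at hz1
    obtain ⟨l, hl, hl'⟩ := h.mem_middleRelations hs ((Submodule.Quotient.mk_eq_zero _).1 hz1)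
    have h0 : ε c l = 0 :=
      h.apply_eq_zero_of_not_isSplitEpiHom hs hk hz2 hz3 (by simpa using hl')
    have h1 : ω • b' - b = l • h.socleElement hs := hl
    have h2 := congrArg (fun a : transposeDual K (e c) ω => a.1 1) h1
    have h3 : b'.1 (1 * ω) - b.1 1 = ε c 1 * ε c l := h2.trans (h.smul_socleElement_apply hs l 1)
    have h4 := transposeDual_apply_rel b' 1
    rw [mul_one] at h4
    rwa [one_mul, h4, h0, mul_zero, zero_sub, neg_eq_zero] at h3)
  have hρ' : ∀ b, ρ (ι b) = b := fun b => LinearMap.congr_fun hρ b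
  have hsur : Function.Surjective (LinearMap.snd R _ _ ∘ₗ E.subtype) := fun q => by
    obtain ⟨b, hb⟩ := h.surjective_projection hs (k q)
    exact ⟨⟨(b, q), by simp [E, hb]⟩, rfl⟩
  obtain ⟨k', hk'⟩ := LinearMap.exists_comp_eq_of_surjective _ hsur
    (LinearMap.fst R _ _ ∘ₗ E.subtype - h.inclusion hs ∘ₗ ρ) (by
      intro z hz
      have h2 : z.1.2 = 0 := hz
      have h1 := hE z
      rw [h2, map_zero] at h1
      obtain ⟨b, hb⟩ := (h.exact_inclusion_projection hs _).1 h1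
      obtain rfl : ι b = z := Subtype.ext (Prod.ext hb h2.symm)
      simp only [LinearMap.sub_apply, LinearMap.comp_apply, hρ']
      exact sub_self _)
  refine ⟨k', ?_⟩
  ext q
  obtain ⟨z, rfl⟩ := hsur q
  have hz := LinearMap.congr_fun hk' z
  rw [LinearMap.comp_apply] at hz
  rw [LinearMap.comp_apply, hz]
  simp only [LinearMap.sub_apply, LinearMap.comp_apply, map_sub,
    (h.exact_inclusion_projection hs).apply_apply_eq_zero, sub_zero]
  exact hE z

theorem isAlmostSplitSequence [Module.Finite K R] [IsNoetherian R U] :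
    IsAlmostSplitSequence (h.inclusion hs) (h.projection hs) where
  injective := h.injective_inclusion hs
  exact := h.exact_inclusion_projection hs
  surjective := h.surjective_projection hs
  leftAlmostSplit := h.isLeftAlmostSplit_inclusion hs
  rightAlmostSplit := h.isRightAlmostSplit_projection hs

theorem eq_bot_or_eq_bot_of_le_ker [Module.Finite K R] {K₁ K₂ : Submodule R (h.Middle hs)}
    (h₁ : K₁ ≤ LinearMap.ker (h.projection hs)) (h₂ : K₂ ≤ LinearMap.ker (h.projection hs))
    (hd : Disjoint K₁ K₂) : K₁ = ⊥ ∨ K₂ = ⊥ := by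
  have key : ∀ L : Submodule R (h.Middle hs), L ≤ LinearMap.ker (h.projection hs) → L ≠ ⊥ →
      h.inclusion hs (h.socleElement hs) ∈ L := by
    intro L hL hL0
    refine h.socleElement_mem hs (M := L.comap (h.inclusion hs)) fun h0 => ?_
    obtain ⟨b, hb, hb0⟩ := Submodule.exists_mem_ne_zero_of_ne_bot hL0
    obtain ⟨b', rfl⟩ := (h.exact_inclusion_projection hs b).1 (hL hb)
    have : b' = 0 := by
      rw [← Submodule.mem_bot R, ← h0]
      exact hb
    exact hb0 (by rw [this, map_zero])
  by_contra! hne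
  have h0 := Submodule.disjoint_def.1 hd _ (key _ h₁ hne.1) (key _ h₂ hne.2)
  have h1 : h.socleElement hs = 0 := h.injective_inclusion hs (h0.trans (map_zero _).symm)
  have h2 := h.socleElement_apply_one hs
  rw [h1] at h2
  exact zero_ne_one h2

theorem alphaLE_two_and_alphaEq_one (hs : IsSplitBasic e ε)
    (h : IsOneRelation e a c ω x)
    [Module.Finite K R] [IsNoetherian R U]
    (hchain : ∀ N N' : Submodule R U, N ≤ N' ∨ N' ≤ N) (hx : x ≠ 0) :
    AlphaLE R U 2 ∧
      (¬ IsIrreducibleInclusion (Ring.jacobson R • (⊤ : Submodule R U)) → AlphaEq R U 1) := by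
  have := IsArtinianRing.of_finite K R
  have : Nontrivial U := ⟨⟨x, 0, hx⟩⟩
  exact _root_.alphaLE_two_and_alphaEq_one (Submodule.jacobson_smul_lt_top ⊤).ne hchain
    (fun N hN => hs.le_jacobson_smul_top hchain hN) (h.isAlmostSplitSequence hs)
    (fun K₁ K₂ => h.eq_bot_or_eq_bot_of_le_ker hs)

end

end IsOneRelation

/-! ### Relations of a uniserial module -/

theorem Submodule.chain_iff {R N : Type*} [Ring R] [AddCommGroup N] [Module R N]
    (P : Submodule R N) : (∀ Q Q' : Submodule R P, Q ≤ Q' ∨ Q' ≤ Q) ↔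
      ∀ L L' : Submodule R N, L ≤ P → L' ≤ P → L ≤ L' ∨ L' ≤ L := by
  constructor
  · intro h L L' hL hL'
    refine (h (L.comap P.subtype) (L'.comap P.subtype)).imp (fun h x hx => ?_) (fun h x hx => ?_)
    · exact h (show (⟨x, hL hx⟩ : P) ∈ _ from hx)
    · exact h (show (⟨x, hL' hx⟩ : P) ∈ _ from hx)
  · intro h Q Q'
    refine (h (Q.map P.subtype) (Q'.map P.subtype) (P.map_subtype_le Q)
      (P.map_subtype_le Q')).imp ?_ ?_ <;>
    exact (Submodule.map_le_map_iff_of_injective P.injective_subtype _ _).1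

/-- The relations of the element `x`, in the projective module generated by the idempotent `f`. -/
def relationModule {R U : Type*} [Ring R] [AddCommGroup U] [Module R U] (f : R) (x : U) :
    Submodule R R :=
  LinearMap.ker (LinearMap.toSpanSingleton R U x) ⊓ Submodule.span R {f}

theorem mem_relationModule {R U : Type*} [Ring R] [AddCommGroup U] [Module R U] {f : R} {x : U}
    (hf : f * f = f) {r : R} : r ∈ relationModule f x ↔ r • x = 0 ∧ r * f = r := by
  refine and_congr_right fun _ => ?_
  change r ∈ Submodule.span R {f} ↔ _
  rw [Submodule.mem_span_singleton]
  constructor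
  · rintro ⟨s, rfl⟩
    rw [smul_eq_mul, mul_assoc, hf]
  · exact fun h => ⟨r, h⟩

theorem mem_radicalMul {R : Type u} [Ring R] {f r : R} :
    r ∈ radicalMul R f ↔ ∃ j ∈ Ring.jacobson R, j * f = r := by
  have h : radicalMul R f = Submodule.map (LinearMap.toSpanSingleton R R f) (Ring.jacobson R) :=
    Submodule.span_eq (Submodule.map (LinearMap.toSpanSingleton R R f) (Ring.jacobson R))
  rw [h]
  exact Iff.rfl

/-! ### Cyclic relation modules, and the radical inclusion when `J p = 0` -/

namespace IsSplitBasic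

variable {K R V : Type u} [Field K] [Ring R] [Algebra K R] [Fintype V]
  {e : V → R} {ε : V → R →ₐ[K] K}
  {U : Type u} [AddCommGroup U] [Module R U] {a : V} {x : U}

theorem mem_jacobson_of_smul_eq_zero (hs : IsSplitBasic e ε)
    (hxa : e a • x = x) (hx : x ≠ 0) {r : R} (hr : r • x = 0)
    (hra : r * e a = r) : r ∈ Ring.jacobson R := by
  rw [← hra]
  refine hs.mul_mem_jacobson ?_
  by_contra hc
  exact hx (hs.eq_zero_of_smul_eq_zero hxa hr hc)

theorem relationModule_le_radicalMul (hs : IsSplitBasic e ε) (hxa : e a • x = x) (hx : x ≠ 0) :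
    relationModule (e a) x ≤ radicalMul R (e a) := fun r hr => by
  obtain ⟨hr, hra⟩ := (mem_relationModule (hs.idem a)).1 hr
  exact mem_radicalMul.2 ⟨r, hs.mem_jacobson_of_smul_eq_zero hxa hx hr hra, hra⟩

/-- Without relations, `r • x ↦ r * e a` would be well defined and would split the projection from
`R` onto `U`. -/
theorem relationModule_ne_bot (hs : IsSplitBasic e ε)
    (hxa : e a • x = x) (hspan : Submodule.span R {x} = ⊤)
    (hproj : ¬ Module.Projective R U) : relationModule (e a) x ≠ ⊥ := by
  intro h0
  apply hproj
  have hsur : Function.Surjective (LinearMap.toSpanSingleton R U x) := fun y =>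
    Submodule.mem_span_singleton.1 (hspan ▸ Submodule.mem_top)
  obtain ⟨σ, hσ⟩ := LinearMap.exists_comp_eq_of_surjective _ hsur
    (LinearMap.toSpanSingleton R R (e a)) (by
      intro r hr
      rw [LinearMap.toSpanSingleton_apply] at hr ⊢
      rw [← Submodule.mem_bot R, ← h0, mem_relationModule (hs.idem a), smul_eq_mul, mul_smul, hxa,
        mul_assoc, hs.idem]
      exact ⟨hr, rfl⟩)
  refine Module.Projective.of_split σ (LinearMap.toSpanSingleton R U x) ?_
  ext y
  obtain ⟨r, rfl⟩ := hsur y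
  have h1 : σ (LinearMap.toSpanSingleton R U x r) = r * e a := LinearMap.congr_fun hσ r
  rw [LinearMap.comp_apply, h1, LinearMap.toSpanSingleton_apply, mul_smul, hxa]
  rfl

theorem isOneRelation (hs : IsSplitBasic e ε)
    (hxa : e a • x = x) (hx : x ≠ 0) (hspan : Submodule.span R {x} = ⊤)
    (hproj : ¬ Module.Projective R U) {c : V} {ω : R} (hω : e c * ω = ω)
    (hrel : relationModule (e a) x = Submodule.span R {ω}) : IsOneRelation e a c ω x := by
  have hmem : ω ∈ relationModule (e a) x := hrel ▸ Submodule.mem_span_singleton_self ω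
  obtain ⟨h1, h2⟩ := (mem_relationModule (hs.idem a)).1 hmem
  refine ⟨hxa, hspan, h1, hω, h2, ?_, hs.mem_jacobson_of_smul_eq_zero hxa hx h1 h2, fun r hr => ?_⟩
  · rintro rfl
    refine hs.relationModule_ne_bot hxa hspan hproj ?_
    rw [hrel, Submodule.span_zero_singleton]
  · rw [← hrel, mem_relationModule (hs.idem a), mul_smul, hxa, mul_assoc, hs.idem]
    exact ⟨hr, rfl⟩

/-- The relations of a module over a projective module with uniserial radical are cyclic. -/
theorem exists_isOneRelation_of_chain (hs : IsSplitBasic e ε)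
    [IsNoetherianRing R] (hxa : e a • x = x) (hx : x ≠ 0)
    (hspan : Submodule.span R {x} = ⊤) (hproj : ¬ Module.Projective R U)
    (hchain : ∀ L L' : Submodule R R, L ≤ radicalMul R (e a) → L' ≤ radicalMul R (e a) →
      L ≤ L' ∨ L' ≤ L) : ∃ c ω, IsOneRelation e a c ω x := by
  have hle := hs.relationModule_le_radicalMul hxa hx
  have : Nonempty V := ⟨a⟩
  obtain ⟨c, ω, hω, hrel⟩ := hs.exists_eq_span (relationModule (e a) x)
    ((Submodule.chain_iff _).2 fun L L' hL hL' => hchain L L' (hL.trans hle) (hL'.trans hle))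
  exact ⟨c, ω, hs.isOneRelation hxa hx hspan hproj hω hrel⟩

/-- If the radical of a projective module is local and a finite sum of uniserial modules, then it is
uniserial. -/
theorem chain_of_eq_span (hs : IsSplitBasic e ε)
    [IsNoetherianRing R] {P : Submodule R R} {d : V} {β : R}
    (hβ : e d * β = β) (hP : P = Submodule.span R {β}) {m : ℕ} {W : Fin m → Submodule R R}
    (hW : ∀ i, IsUniserial R (W i)) (hsup : P = ⨆ i, W i) (L L' : Submodule R R) (hL : L ≤ P)
    (hL' : L' ≤ P) : L ≤ L' ∨ L' ≤ L := by
  by_cases hi : ∃ i, P ≤ W i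
  · obtain ⟨i, hi⟩ := hi
    exact (Submodule.chain_iff _).1 (hW i).2 L L' (hL.trans hi) (hL'.trans hi)
  · push Not at hi
    -- No `W i` contains the generator `β`, so each lies in the radical of the local module `P`. By
    -- Nakayama's lemma, `P` is zero.
    have hle : P ≤ Ring.jacobson R • P := by
      conv_lhs => rw [hsup]
      refine iSup_le fun i z hz => ?_
      have hzP : z ∈ P := hsup ▸ Submodule.mem_iSup_of_mem i hz
      have hβW : β ∉ W i := fun hmem => hi i (by
        rwa [hP, Submodule.span_singleton_le_iff_mem])
      obtain ⟨j, hj, rfl⟩ := hs.exists_mem_jacobson_of_lt_span (N := R) hβ hβW hz (hP ▸ hzP)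
      exact Submodule.smul_mem_smul hj (hP ▸ Submodule.mem_span_singleton_self β)
    have h0 : P = ⊥ := Submodule.FG.eq_bot_of_le_jacobson_smul (IsNoetherian.noetherian P) hle
    exact Or.inl (hL.trans (h0 ▸ bot_le))

/-- The generator `w` of `W'` acts on `x` like an element of `W`, and the difference is `ω`. Modulo
`ω`, both `p` and any relation can be moved into the uniserial `W`. There the relations lie below
`p`, hence in `J p`, up to multiples of `ω`; so `J p = 0` leaves only multiples of `ω`. -/
theorem exists_isOneRelation_of_sup (hs : IsSplitBasic e ε)
    [IsNoetherianRing R] (hxa : e a • x = x) (hx : x ≠ 0)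
    (hspan : Submodule.span R {x} = ⊤) (hproj : ¬ Module.Projective R U)
    (hchain : ∀ N N' : Submodule R U, N ≤ N' ∨ N' ≤ N) {W W' : Submodule R R}
    (hW : IsUniserial R W) (hW' : IsUniserial R W') (hsup : radicalMul R (e a) = W ⊔ W')
    {b : V} {p : R} (hbp : e b * p = p) (hp : p ∈ radicalMul R (e a)) (hpx : p • x ≠ 0)
    (hJp : ∀ j ∈ Ring.jacobson R, j * p = 0) : ∃ c ω, IsOneRelation e a c ω x := by
  wlog hle : W'.map (LinearMap.toSpanSingleton R U x) ≤ W.map (LinearMap.toSpanSingleton R U x)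
    generalizing W W'
  · exact this hW' hW (by rw [sup_comm, hsup]) ((hchain _ _).resolve_left hle)
  have : Nonempty V := ⟨a⟩
  obtain ⟨c, w, hcw, hw⟩ := hs.exists_eq_span W' hW'.2
  rw [smul_eq_mul] at hcw
  have hwW' : w ∈ W' := hw ▸ Submodule.mem_span_singleton_self w
  obtain ⟨v, hvW, hv⟩ := hle ⟨w, hwW', rfl⟩
  rw [LinearMap.toSpanSingleton_apply, LinearMap.toSpanSingleton_apply] at hv
  have hrad : ∀ r ∈ radicalMul R (e a), r * e a = r := by
    intro r hr
    obtain ⟨j, -, rfl⟩ := mem_radicalMul.1 hr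
    rw [mul_assoc, hs.idem]
  have hsplit : ∀ r ∈ radicalMul R (e a), ∃ y ∈ W, ∃ l, r = y + l * w := by
    intro r hr
    rw [hsup] at hr
    obtain ⟨y, hy, z, hz, rfl⟩ := Submodule.mem_sup.1 hr
    rw [hw] at hz
    obtain ⟨l, rfl⟩ := Submodule.mem_span_singleton.1 hz
    exact ⟨y, hy, l, rfl⟩
  have hvW' : e c * v ∈ W := W.smul_mem _ hvW
  set ω := w - e c * v with hωdef
  have hωx : ω • x = 0 := by
    rw [sub_smul, mul_smul, hv, ← mul_smul, hcw, sub_self]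
  have hωrel : ω ∈ relationModule (e a) x := by
    refine (mem_relationModule (hs.idem a)).2 ⟨hωx, hrad _ ?_⟩
    rw [hsup]
    exact sub_mem (Submodule.mem_sup_right hwW') (Submodule.mem_sup_left hvW')
  refine ⟨c, ω, hs.isOneRelation hxa hx hspan hproj ?_ (le_antisymm ?_ ?_)⟩
  · rw [hωdef, mul_sub, hcw, ← mul_assoc, hs.idem]
  · intro z hz
    obtain ⟨z₁, hz₁, l, rfl⟩ := hsplit z (hs.relationModule_le_radicalMul hxa hx hz)
    obtain ⟨p₁, hp₁, s, hps⟩ := hsplit p hp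
    have hy : z₁ + l * (e c * v) ∈ relationModule (e a) x := by
      have : z₁ + l * (e c * v) = z₁ + l * w - l • ω := by
        rw [smul_eq_mul, hωdef, mul_sub]
        abel
      rw [this]
      exact sub_mem hz (Submodule.smul_mem _ _ hωrel)
    have hyW : z₁ + l * (e c * v) ∈ W := add_mem hz₁ (W.smul_mem l hvW')
    have hq : e b * (p₁ + s * (e c * v)) = p - e b * s * ω := by
      rw [← hbp, hps, hωdef]
      noncomm_ring
    set q := e b * (p₁ + s * (e c * v))
    have hqW : q ∈ W := W.smul_mem _ (add_mem hp₁ (W.smul_mem s hvW'))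
    have hqrel : q ∉ relationModule (e a) x := fun h => by
      have := ((mem_relationModule (hs.idem a)).1 h).1
      rw [hq, sub_smul, mul_smul, hωx, smul_zero, sub_zero] at this
      exact hpx this
    -- In the chain of submodules of `W`, the relations lie below `q`, since `q • x = p • x` is
    -- nonzero.
    have hyq : z₁ + l * (e c * v) ∈ Submodule.span R {q} := by
      rcases (Submodule.chain_iff W).1 hW.2 (relationModule (e a) x ⊓ W) (Submodule.span R {q})
        inf_le_right ((Submodule.span_singleton_le_iff_mem _ _).2 hqW) with h | h
      · exact h ⟨hy, hyW⟩
      · exact absurd (h (Submodule.mem_span_singleton_self q)).1 hqrel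
    obtain ⟨j, hj, hjq⟩ := hs.exists_mem_jacobson_of_lt_span (N := R) (v := b)
      (by rw [smul_eq_mul, ← mul_assoc, hs.idem]) hqrel hy hyq
    have : z₁ + l * w = (l - j * (e b * s)) • ω := by
      have h1 : z₁ + l * w = (z₁ + l * (e c * v)) + l * ω := by
        rw [hωdef, mul_sub]
        abel
      rw [h1, hjq, hq, smul_eq_mul, smul_eq_mul, mul_sub, hJp j hj]
      noncomm_ring
    rw [this]
    exact Submodule.smul_mem _ _ (Submodule.mem_span_singleton_self ω)
  · rwa [Submodule.span_singleton_le_iff_mem]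

/-- The inclusion of the radical is not irreducible if the radical annihilates a mast. -/
theorem not_isIrreducibleInclusion (hs : IsSplitBasic e ε) [IsNoetherianRing R] {c : V} {ω : R}
    (h : IsOneRelation e a c ω x)
    (hx : x ∉ Ring.jacobson R • (⊤ : Submodule R U))
    {b : V} {p : R} (hbp : e b * p = p) (hpa : p * e a = p) (hp : p ∈ Ring.jacobson R)
    (hpx : p • x ≠ 0) (hJp : ∀ j ∈ Ring.jacobson R, j * p = 0)
    (hpJ : ∀ y ∈ Ring.jacobson R • (⊤ : Submodule R U), p • y = 0) :
    ¬ IsIrreducibleInclusion (Ring.jacobson R • (⊤ : Submodule R U)) := by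
  rintro ⟨-, hirr⟩
  set M : Submodule R U := Ring.jacobson R • (⊤ : Submodule R U) with hMdef
  have hJM : ∀ j ∈ Ring.jacobson R, ∀ y : U, j • y ∈ M := fun j hj y =>
    Submodule.smul_mem_smul hj Submodule.mem_top
  have : Module.Finite R U := ⟨⟨{x}, by rw [Finset.coe_singleton, h.span_eq_top]⟩⟩
  let px : M := ⟨p • x, hJM p hp x⟩
  -- The inclusion of `M` is factored through the amalgamation of `R` and `M` that identifies `p`
  -- with `p • x`.
  let S : Submodule R (R × M) := Submodule.span R {(p, -px)}
  let k : M →ₗ[R] (R × M) ⧸ S := S.mkQ ∘ₗ LinearMap.inr R R M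
  let l : (R × M) ⧸ S →ₗ[R] U := S.liftQ ((LinearMap.toSpanSingleton R U x).coprod M.subtype) (by
    rw [Submodule.span_le]
    rintro _ rfl
    simp [px])
  have hl : ∀ r u, l (S.mkQ (r, u)) = r • x + u := fun r u => rfl
  have hlk : l ∘ₗ k = M.subtype := by
    ext u
    change l (S.mkQ (0, u)) = u
    rw [hl, zero_smul, zero_add]
  obtain ⟨ρ, hρ⟩ := hirr _ k l hlk (by
    rintro ⟨s, hsl⟩
    obtain ⟨⟨r, u⟩, hru⟩ := S.mkQ_surjective (s x)
    have hx1 : r • x + u = x := by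
      rw [← hl, hru]
      exact LinearMap.congr_fun hsl x
    have hmem : (ω * r, ω • u) ∈ S := by
      rw [← Submodule.Quotient.mk_eq_zero S]
      change S.mkQ (ω • (r, u)) = 0
      rw [map_smul, hru, ← map_smul, h.rel_smul, map_zero]
    obtain ⟨t, ht⟩ := Submodule.mem_span_singleton.1 hmem
    have ht1 : t * p = ω * r := congrArg Prod.fst ht
    have hc : ε a r ≠ 0 := fun hc => hx (by
      rw [← hx1, ← h.smul_self, ← mul_smul]
      exact add_mem (hJM _ (hs.mul_mem_jacobson hc) x) u.2)
    have hj : e a * (r * e a) - ε a r • e a ∈ Ring.jacobson R := by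
      have := hs.mul_sub_smul_mem_jacobson (e a * r) a
      rwa [map_mul, hs.apply_self, one_mul, mul_assoc] at this
    -- The unit `w` is chosen so that `ω * w = ω * r * e a`. A section of `l` would thus express `ω`
    -- through `p`, and `ω • x = 0` would force `ω = 0`.
    obtain ⟨w, hw⟩ := hs.isUnit_smul_add hc hj
    have hωw : ω * w = t * p := by
      rw [hw, mul_add, mul_sub, ← mul_assoc ω, h.mul_right, mul_smul_comm, h.mul_right,
        ← mul_assoc, ← ht1, mul_assoc, hpa, ← Algebra.commutes, ← Algebra.smul_def]
      abel
    have hω : ω = t * p * ↑w⁻¹ := by rw [← hωw, Units.mul_inv_cancel_right]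
    have hinv : (↑w⁻¹ : R) - algebraMap K R (ε a r)⁻¹ ∈ Ring.jacobson R := by
      rw [hs.mem_jacobson]
      intro v
      have h1 : ε v (w : R) = ε a r := by
        rw [hw, map_add, (hs.mem_jacobson _).1 hj v, add_zero, AlgHom.commutes]
        rfl
      have h2 : ε v (w : R) * ε v (↑w⁻¹ : R) = 1 := by rw [← map_mul, Units.mul_inv, map_one]
      rw [map_sub, AlgHom.commutes, eq_inv_of_mul_eq_one_right h2, h1]
      exact sub_self _
    have htp : t * p = ε b t • p := by
      have h1 := hJp _ (hs.mul_sub_smul_mem_jacobson t b)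
      rw [sub_mul, mul_assoc, hbp, smul_mul_assoc, hbp, sub_eq_zero] at h1
      exact h1
    have hpw : p • (↑w⁻¹ : R) • x = algebraMap K R (ε a r)⁻¹ • p • x := by
      have h1 := hpJ _ (hJM _ hinv x)
      rw [sub_smul, smul_sub, sub_eq_zero] at h1
      rw [h1, ← mul_smul, ← Algebra.commutes, mul_smul]
    have h0 : algebraMap K R (ε b t * (ε a r)⁻¹) • p • x = 0 := by
      rw [map_mul, mul_smul, ← hpw, ← mul_smul, ← Algebra.smul_def, ← htp, ← mul_smul, ← hω,
        h.rel_smul]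
    have ht0 : ε b t = 0 := by
      by_contra hne
      have hne' : ε b t * (ε a r)⁻¹ ≠ 0 := mul_ne_zero hne (inv_ne_zero hc)
      exact hpx ((((IsUnit.mk0 _ hne').map (algebraMap K R)).smul_eq_zero).1 h0)
    exact h.ne_zero (by rw [hω, htp, ht0, zero_smul, zero_mul]))
  -- A retraction `ρ` of `k` would make `p • x` a multiple by `p` of an element of the radical of
  -- `U`, which `p` annihilates.
  have h1 : p • ρ (S.mkQ (1, 0)) = px := by
    rw [← map_smul, ← map_smul]
    have h2 : S.mkQ (p • (1, 0)) = k px := by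
      rw [← sub_eq_zero]
      change S.mkQ (p • (1, 0)) - S.mkQ (0, px) = 0
      rw [← map_sub]
      refine (Submodule.Quotient.mk_eq_zero S).2 (Submodule.subset_span ?_)
      simp
    rw [h2]
    exact LinearMap.congr_fun hρ px
  have h2 := hpJ _ (ρ (S.mkQ (1, 0))).2
  rw [← Submodule.coe_smul, h1] at h2
  exact hpx h2

end IsSplitBasic

/-! ### Quotients of path algebras by admissible ideals -/

namespace PathAlgebra

variable {K V : Type u} [Field K] [Quiver.{u} V]

/-- The coefficient of the trivial path at `v`, as a linear map. -/
noncomputable def counitLinear (v : V) : PathAlgebra K V →ₗ[K] K :=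
  (Finsupp.lapply (⟨v, v, Quiver.Path.nil⟩ : QuiverPath V) : (QuiverPath V →₀ K) →ₗ[K] K)

theorem counitLinear_nil_self (v : V) :
    counitLinear v (ofPath K (Quiver.Path.nil : Quiver.Path v v)) = 1 :=
  Finsupp.single_eq_same

theorem counitLinear_eq_zero_of_ne {v a b : V} (p : Quiver.Path a b) (h : a ≠ v) :
    counitLinear v (ofPath K p) = 0 :=
  Finsupp.single_eq_of_ne fun h' => h (congrArg Sigma.fst h').symm

theorem counitLinear_eq_zero_of_length_pos {v a b : V} (p : Quiver.Path a b) (h : 0 < p.length) :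
    counitLinear v (ofPath K p) = 0 :=
  Finsupp.single_eq_of_ne fun h' => by
    have := congrArg (fun q : QuiverPath V => q.2.2.length) h'
    simp only [Quiver.Path.length_nil] at this
    omega

theorem counitLinear_mul (v : V) (x y : PathAlgebra K V) :
    counitLinear v (x * y) = counitLinear v x * counitLinear v y := by
  induction x using induction_on with
  | zero => rw [PathAlgebra.zero_mul', map_zero, zero_mul]
  | add x x' h h' => rw [PathAlgebra.add_mul', map_add, map_add, h, h', add_mul]
  | smul c x h => rw [PathAlgebra.smul_mul', map_smul, map_smul, h, smul_mul_assoc]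
  | path b c q =>
    induction y using induction_on with
    | zero => rw [PathAlgebra.mul_zero', map_zero, mul_zero]
    | add x x' h h' => rw [PathAlgebra.mul_add', map_add, map_add, h, h', mul_add]
    | smul c x h => rw [PathAlgebra.mul_smul', map_smul, map_smul, h, mul_smul_comm]
    | path a b' p =>
      by_cases hb : b = b'
      · subst hb
        rw [ofPath_mul_ofPath]
        cases p with
        | nil =>
          rw [Quiver.Path.nil_comp]
          by_cases hv : b = v
          · subst hv
            rw [counitLinear_nil_self, mul_one]
          · rw [counitLinear_eq_zero_of_ne q hv, zero_mul]
        | cons p α =>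
          rw [counitLinear_eq_zero_of_length_pos, counitLinear_eq_zero_of_length_pos (p.cons α),
            mul_zero]
          · simp
          · rw [Quiver.Path.length_comp, Quiver.Path.length_cons]
            omega
      · rw [ofPath_mul_ofPath_of_ne _ _ hb, map_zero]
        by_cases hv : b = v
        · subst hv
          cases p with
          | nil => rw [counitLinear_eq_zero_of_ne Quiver.Path.nil (Ne.symm hb), mul_zero]
          | cons p α =>
            rw [counitLinear_eq_zero_of_length_pos (p.cons α) (by simp), mul_zero]
        · rw [counitLinear_eq_zero_of_ne q hv, zero_mul]

theorem ofPath_mem_lengthGE {a b : V} (p : Quiver.Path a b) {n : ℕ} (h : n ≤ p.length) :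
    ofPath K p ∈ lengthGE K V n :=
  Submodule.subset_span ⟨a, b, p, h, rfl⟩

theorem counitLinear_eq_zero_of_mem {v : V} {n : ℕ} (hn : 0 < n) {x : PathAlgebra K V}
    (hx : x ∈ lengthGE K V n) : counitLinear v x = 0 := by
  have : lengthGE K V n ≤ LinearMap.ker (counitLinear v) := by
    rw [lengthGE, Submodule.span_le]
    rintro _ ⟨a, b, p, hp, rfl⟩
    exact counitLinear_eq_zero_of_length_pos p (hn.trans_le hp)
  exact this hx

theorem mul_mem_lengthGE {i j : ℕ} {x y : PathAlgebra K V} (hx : x ∈ lengthGE K V i)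
    (hy : y ∈ lengthGE K V j) : x * y ∈ lengthGE K V (i + j) := by
  induction hx using Submodule.span_induction with
  | zero => rw [PathAlgebra.zero_mul']; exact zero_mem _
  | add x x' _ _ h h' => rw [PathAlgebra.add_mul']; exact add_mem h h'
  | smul c x _ h => rw [PathAlgebra.smul_mul']; exact Submodule.smul_mem _ _ h
  | mem x hx =>
    obtain ⟨b, c, q, hq, rfl⟩ := hx
    induction hy using Submodule.span_induction with
    | zero => rw [PathAlgebra.mul_zero']; exact zero_mem _
    | add x x' _ _ h h' => rw [PathAlgebra.mul_add']; exact add_mem h h'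
    | smul c x _ h => rw [PathAlgebra.mul_smul']; exact Submodule.smul_mem _ _ h
    | mem y hy =>
      obtain ⟨a, b', p, hp, rfl⟩ := hy
      by_cases hb : b = b'
      · subst hb
        rw [ofPath_mul_ofPath]
        exact ofPath_mem_lengthGE _ (by rw [Quiver.Path.length_comp]; omega)
      · rw [ofPath_mul_ofPath_of_ne _ _ hb]
        exact zero_mem _

theorem finite_length_eq [Finite V] [∀ a b : V, Finite (a ⟶ b)] (n : ℕ) :
    {q : QuiverPath V | q.2.2.length = n}.Finite := by
  induction n with
  | zero =>
    refine (Set.finite_range fun v : V => (⟨v, v, Quiver.Path.nil⟩ : QuiverPath V)).subset ?_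
    rintro ⟨a, b, p⟩ hp
    cases p with
    | nil => exact ⟨a, rfl⟩
    | cons p α => simp at hp
  | succ n ih =>
    refine (ih.biUnion fun q _ => Set.finite_range fun α : Σ c, (q.2.1 ⟶ c) =>
      (⟨q.1, α.1, q.2.2.cons α.2⟩ : QuiverPath V)).subset ?_
    rintro ⟨a, c, p⟩ hp
    cases p with
    | nil => simp at hp
    | @cons b _ p α =>
      simp only [Set.mem_ofPred_eq, Quiver.Path.length_cons, Nat.add_right_cancel_iff] at hp
      exact Set.mem_biUnion (x := (⟨a, b, p⟩ : QuiverPath V)) hp ⟨⟨c, α⟩, rfl⟩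

variable [Fintype V]

/-- The coefficient of the trivial path at `v`, as an algebra homomorphism. -/
noncomputable def counit (v : V) : PathAlgebra K V →ₐ[K] K :=
  AlgHom.ofLinearMap (counitLinear v) (by
    rw [one_def, map_sum, Finset.sum_eq_single v]
    · exact counitLinear_nil_self v
    · exact fun w _ hw => counitLinear_eq_zero_of_ne _ hw
    · exact fun h => absurd (Finset.mem_univ v) h) (counitLinear_mul v)

theorem counit_apply (v : V) (x : PathAlgebra K V) : counit v x = counitLinear v x := rfl

theorem sub_sum_counit_mem (x : PathAlgebra K V) :
    x - ∑ v, counit v x • ofPath K (Quiver.Path.nil : Quiver.Path v v) ∈ lengthGE K V 1 := by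
  induction x using induction_on with
  | zero => simp
  | add x y hx hy =>
    have := add_mem hx hy
    simp only [map_add, add_smul, Finset.sum_add_distrib]
    convert this using 1
    abel
  | smul c x hx =>
    have := Submodule.smul_mem _ c hx
    rw [smul_sub, Finset.smul_sum] at this
    simpa only [map_smul, smul_assoc] using this
  | path a b p =>
    cases p with
    | nil =>
      rw [Finset.sum_eq_single a]
      · rw [counit_apply, counitLinear_nil_self, one_smul, sub_self]
        exact zero_mem _
      · intro v _ hv
        rw [counit_apply, counitLinear_eq_zero_of_ne _ hv.symm, zero_smul]
      · exact fun h => absurd (Finset.mem_univ a) h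
    | cons p α =>
      rw [Finset.sum_eq_zero, sub_zero]
      · exact ofPath_mem_lengthGE _ (by simp)
      · intro v _
        rw [counit_apply, counitLinear_eq_zero_of_length_pos _ (by simp), zero_smul]

theorem mem_lengthGE_one {x : PathAlgebra K V} (hx : ∀ v, counit v x = 0) :
    x ∈ lengthGE K V 1 := by
  simpa [hx] using sub_sum_counit_mem x

theorem pow_mem_lengthGE {x : PathAlgebra K V} (hx : x ∈ lengthGE K V 1) (n : ℕ) :
    x ^ n ∈ lengthGE K V n := by
  induction n with
  | zero =>
    rw [pow_zero, one_def]
    exact sum_mem fun v _ => ofPath_mem_lengthGE _ (Nat.zero_le _)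
  | succ n ih =>
    rw [pow_succ]
    exact mul_mem_lengthGE ih hx

/-! ### The quotient algebra is split basic and finite-dimensional -/

section Quotient

variable (I : Ideal (PathAlgebra K V)) [I.IsTwoSided]

theorem pathClass_mul_pathClass {a b c : V} (q : Quiver.Path b c) (p : Quiver.Path a b) :
    pathClass I q * pathClass I p = pathClass I (p.comp q) := by
  rw [pathClass, pathClass, ← map_mul, ofPath_mul_ofPath]
  rfl

theorem pathClass_mul_pathClass_of_ne {a b c d : V} (q : Quiver.Path c d) (p : Quiver.Path a b)
    (h : c ≠ b) : pathClass I q * pathClass I p = 0 := by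
  rw [pathClass, pathClass, ← map_mul, ofPath_mul_ofPath_of_ne _ _ h, map_zero]

variable {I}

/-- The character of the quotient algebra at the vertex `v`. -/
noncomputable def quotientCounit (hI : IsAdmissible I) (v : V) : (PathAlgebra K V ⧸ I) →ₐ[K] K :=
  Ideal.Quotient.liftₐ I (counit v) fun x hx =>
    counitLinear_eq_zero_of_mem (n := 2) (by norm_num) (hI.1 x hx)

theorem isNilpotent_of_quotientCounit (hI : IsAdmissible I) {r : PathAlgebra K V ⧸ I}
    (hr : ∀ v, quotientCounit hI v r = 0) : IsNilpotent r := by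
  obtain ⟨x, rfl⟩ := Ideal.Quotient.mk_surjective r
  obtain ⟨N, hN⟩ := hI.2
  refine ⟨N, ?_⟩
  rw [← map_pow]
  exact Ideal.Quotient.eq_zero_iff_mem.2 (hN _ (pow_mem_lengthGE (mem_lengthGE_one hr) N))

theorem isSplitBasic (hI : IsAdmissible I) :
    IsSplitBasic (fun v => pathClass I (Quiver.Path.nil : Quiver.Path v v))
      (quotientCounit hI) where
  idem v := by rw [pathClass_mul_pathClass, Quiver.Path.nil_comp]
  sum_eq_one := by
    simp only [pathClass]
    rw [← map_sum, ← one_def, map_one]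
  apply_self v := counitLinear_nil_self v
  apply_of_ne v w h := counitLinear_eq_zero_of_ne _ h.symm
  mem_jacobson r := by
    rw [← Ideal.jacobson_bot, Ideal.mem_jacobson_iff]
    constructor
    · intro h v
      by_contra hc
      -- The scalar makes `1 + y * r` vanish under the character at `v`, so it has no left inverse.
      obtain ⟨z, hz⟩ := h (algebraMap K _ (-(quotientCounit hI v r)⁻¹))
      have h1 := congrArg (quotientCounit hI v) ((Submodule.mem_bot _).1 hz)
      rw [map_sub, map_add, map_mul, map_mul, AlgHom.commutes, map_one, map_zero] at h1
      simp only [Algebra.algebraMap_self, RingHom.id_apply] at h1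
      rw [mul_assoc, neg_mul, inv_mul_cancel₀ hc] at h1
      simp at h1
    · intro h y
      obtain ⟨u, hu⟩ := (isNilpotent_of_quotientCounit hI (r := y * r) fun v => by
        rw [map_mul, h, mul_zero]).isUnit_one_add
      refine ⟨↑u⁻¹, ?_⟩
      have h1 : (↑u⁻¹ : PathAlgebra K V ⧸ I) * u = 1 := u.inv_mul
      rw [hu, mul_add, mul_one, ← mul_assoc] at h1
      rw [Submodule.mem_bot, add_comm, h1, sub_self]
  nilpotent r h := isNilpotent_of_quotientCounit hI h

theorem finite_quotient [∀ a b : V, Finite (a ⟶ b)] (hI : IsAdmissible I) :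
    Module.Finite K (PathAlgebra K V ⧸ I) := by
  obtain ⟨N, hN⟩ := hI.2
  have hfin : {q : QuiverPath V | q.2.2.length < N}.Finite := by
    refine ((Set.finite_lt_nat N).biUnion fun n _ => finite_length_eq (V := V) n).subset ?_
    intro q hq
    exact Set.mem_biUnion (x := q.2.2.length) hq rfl
  refine ⟨Submodule.fg_def.2 ⟨_, hfin.image fun q : QuiverPath V => pathClass I q.2.2, ?_⟩⟩
  rw [eq_top_iff]
  rintro r -
  obtain ⟨x, rfl⟩ := Ideal.Quotient.mk_surjective r
  induction x using induction_on with
  | zero => rw [map_zero]; exact zero_mem _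
  | add x y hx hy => rw [map_add]; exact add_mem hx hy
  | smul c x hx =>
    have : Ideal.Quotient.mk I (c • x) = c • Ideal.Quotient.mk I x :=
      map_smul (Ideal.Quotient.mkₐ K I) c x
    rw [this]
    exact Submodule.smul_mem _ _ hx
  | path a b p =>
    by_cases hp : p.length < N
    · exact Submodule.subset_span ⟨⟨a, b, p⟩, hp, rfl⟩
    · rw [Ideal.Quotient.eq_zero_iff_mem.2 (hN _ (ofPath_mem_lengthGE p (not_lt.1 hp)))]
      exact zero_mem _

theorem pathClass_mem_jacobson (hI : IsAdmissible I) {a b : V} (p : Quiver.Path a b)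
    (hp : 0 < p.length) : pathClass I p ∈ Ring.jacobson (PathAlgebra K V ⧸ I) :=
  ((isSplitBasic hI).mem_jacobson _).2 fun _ => counitLinear_eq_zero_of_length_pos p hp

/-- If exactly one arrow starts at `a`, then the radical of the projective module at `a` is
generated by this arrow. -/
theorem radicalMul_eq_span (hI : IsAdmissible I) {a : V} (h : Nat.card (Σ c : V, a ⟶ c) = 1) :
    ∃ (d : V) (β : a ⟶ d), radicalMul (PathAlgebra K V ⧸ I)
      (pathClass I (Quiver.Path.nil : Quiver.Path a a)) =
        Submodule.span _ {pathClass I β.toPath} := by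
  obtain ⟨hsub, ⟨⟨d, β⟩⟩⟩ := Nat.card_eq_one_iff_unique.1 h
  refine ⟨d, β, le_antisymm ?_ ?_⟩
  · intro r hr
    obtain ⟨j, hj, rfl⟩ := mem_radicalMul.1 hr
    obtain ⟨x, rfl⟩ := Ideal.Quotient.mk_surjective j
    have hx : x ∈ lengthGE K V 1 := mem_lengthGE_one (((isSplitBasic hI).mem_jacobson _).1 hj)
    clear hj hr
    induction hx using Submodule.span_induction with
    | zero => rw [map_zero, zero_mul]; exact zero_mem _
    | add x y _ _ hx hy => rw [map_add, add_mul]; exact add_mem hx hy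
    | smul c x _ hx =>
      have : Ideal.Quotient.mk I (c • x) = c • Ideal.Quotient.mk I x :=
        map_smul (Ideal.Quotient.mkₐ K I) c x
      rw [this, smul_mul_assoc]
      exact Submodule.smul_of_tower_mem _ c hx
    | mem x hx =>
      obtain ⟨b, c, q, hq, rfl⟩ := hx
      change pathClass I q * _ ∈ _
      by_cases hb : b = a
      · subst hb
        -- The first arrow of the path is split off; it starts at the given vertex, so it must be
        -- `β`.
        obtain ⟨d', α, q', -, rfl⟩ := q.eq_toPath_comp_of_length_eq_succ (n := q.length - 1) (by omega)
        rw [pathClass_mul_pathClass, Quiver.Path.nil_comp, ← pathClass_mul_pathClass]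
        obtain ⟨rfl, hα⟩ := Sigma.mk.inj_iff.1 (Subsingleton.elim (⟨d', α⟩ : Σ c : V, b ⟶ c) ⟨d, β⟩)
        obtain rfl := eq_of_heq hα
        exact Submodule.smul_mem _ _ (Submodule.mem_span_singleton_self _)
      · rw [pathClass_mul_pathClass_of_ne _ _ _ hb]
        exact zero_mem _
  · rw [Submodule.span_singleton_le_iff_mem]
    refine mem_radicalMul.2 ⟨_, pathClass_mem_jacobson hI β.toPath (by simp), ?_⟩
    rw [pathClass_mul_pathClass, Quiver.Path.nil_comp]

end Quotient

end PathAlgebra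

/-! ### The radical series -/

/-- The radical series of a module. -/
noncomputable def radicalSeries (R U : Type*) [Ring R] [AddCommGroup U] [Module R U] :
    ℕ → Submodule R U
  | 0 => ⊤
  | n + 1 => Ring.jacobson R • radicalSeries R U n

/-- By Nakayama's lemma the series drops strictly until it reaches zero. -/
theorem le_coheight_radicalSeries {R U : Type*} [Ring R] [AddCommGroup U] [Module R U]
    [IsNoetherian R U] (n : ℕ) : radicalSeries R U n = ⊥ ∨
      (n : ℕ∞) ≤ Order.coheight (radicalSeries R U n) := by
  induction n with
  | zero => exact Or.inr (by simp)
  | succ n ih =>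
    by_cases h0 : radicalSeries R U n = ⊥
    · left
      rw [radicalSeries, h0, Submodule.smul_bot]
    · right
      have hlt : radicalSeries R U (n + 1) < radicalSeries R U n :=
        Submodule.FG.jacobson_smul_lt h0 (IsNoetherian.noetherian _)
      push_cast
      exact (add_le_add_left (ih.resolve_left h0) 1).trans (Order.coheight_add_one_le hlt)

theorem radicalSeries_eq_bot {R U : Type*} [Ring R] [AddCommGroup U] [Module R U]
    [IsNoetherian R U] {n : ℕ} (hn : Module.length R U = n) : radicalSeries R U n = ⊥ := by
  by_contra h0
  have h1 := (le_coheight_radicalSeries n).resolve_left h0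
  have h2 := Order.coheight_add_one_le (bot_lt_iff_ne_bot.2 h0)
  rw [← Module.length_eq_coheight, hn] at h2
  have h3 : ((n + 1 : ℕ) : ℕ∞) ≤ n := by
    push_cast
    exact (add_le_add_left h1 1).trans h2
  have := Nat.cast_le.1 h3
  omega

theorem PathAlgebra.pathClass_smul_mem_radicalSeries {K V : Type u} [Field K] [Quiver.{u} V]
    [Fintype V] {I : Ideal (PathAlgebra K V)} [I.IsTwoSided] (hI : IsAdmissible I)
    {U : Type*} [AddCommGroup U] [Module (PathAlgebra K V ⧸ I) U] {a b : V} (p : Quiver.Path a b)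
    {n : ℕ} {y : U} (hy : y ∈ radicalSeries (PathAlgebra K V ⧸ I) U n) :
    pathClass I p • y ∈ radicalSeries (PathAlgebra K V ⧸ I) U (n + p.length) := by
  induction p with
  | nil => exact Submodule.smul_mem _ _ hy
  | cons p α ih =>
    rw [← Quiver.Path.comp_toPath_eq_cons, ← pathClass_mul_pathClass, mul_smul,
      Quiver.Path.length_comp, Quiver.Path.length_toPath, ← add_assoc]
    exact Submodule.smul_mem_smul (pathClass_mem_jacobson hI _ (by simp)) ih

/-! ### The three statements -/

theorem mainTheorem12 {K V : Type u} [Field K] [Quiver.{u} V] [Fintype V]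
    [∀ a b : V, Finite (a ⟶ b)]
    (I : Ideal (PathAlgebra K V)) [I.IsTwoSided] (hI : PathAlgebra.IsAdmissible I)
    (m : ℕ) (hm : IsLeftMultiserial (PathAlgebra K V ⧸ I) m)
    (U : Type u) [AddCommGroup U] [Module (PathAlgebra K V ⧸ I) U]
    (hU : IsUniserial (PathAlgebra K V ⧸ I) U)
    (hproj : ¬ Module.Projective (PathAlgebra K V ⧸ I) U)
    {a b : V} (p : Quiver.Path a b) (hp : IsMast I p U) :
    (m = 1 → AlphaLE (PathAlgebra K V ⧸ I) U 2) ∧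
    (Nat.card (Σ c : V, a ⟶ c) = 1 → AlphaLE (PathAlgebra K V ⧸ I) U 2) ∧
    (m = 2 → (∀ j ∈ Ring.jacobson (PathAlgebra K V ⧸ I), j * PathAlgebra.pathClass I p = 0) →
      AlphaEq (PathAlgebra K V ⧸ I) U 1) := by
  have hs := PathAlgebra.isSplitBasic hI
  have hfin := PathAlgebra.finite_quotient hI
  have hnoeth : IsNoetherian (PathAlgebra K V ⧸ I) U :=
    (isFiniteLength_iff_isNoetherian_isArtinian.1 hU.1).1
  have hR : IsNoetherianRing (PathAlgebra K V ⧸ I) := IsNoetherianRing.of_finite K _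
  obtain ⟨hlen, x₀, hx₀⟩ := hp
  set e : V → PathAlgebra K V ⧸ I :=
    fun v => PathAlgebra.pathClass I (Quiver.Path.nil : Quiver.Path v v) with he
  set P := PathAlgebra.pathClass I p with hP
  have hPa : P * e a = P := by
    rw [hP, he, PathAlgebra.pathClass_mul_pathClass, Quiver.Path.nil_comp]
  have hbP : e b * P = P := by
    rw [hP, he, PathAlgebra.pathClass_mul_pathClass, Quiver.Path.comp_nil]
  -- The mast is one shorter than the length of `U`, so it maps the radical into a term of the
  -- radical series that is already zero.
  have hPJ : ∀ y ∈ Ring.jacobson (PathAlgebra K V ⧸ I) • (⊤ : Submodule (PathAlgebra K V ⧸ I) U),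
      P • y = 0 := fun y hy => by
    have h1 := PathAlgebra.pathClass_smul_mem_radicalSeries hI p (n := 1) hy
    rw [add_comm, radicalSeries_eq_bot (by rw [hlen]; push_cast; rfl)] at h1
    exact h1
  obtain ⟨x, hxa, hPx⟩ : ∃ x : U, e a • x = x ∧ P • x ≠ 0 :=
    ⟨e a • x₀, by rw [← mul_smul, hs.idem], by rwa [← mul_smul, hPa]⟩
  have hxJ : x ∉ Ring.jacobson (PathAlgebra K V ⧸ I) • (⊤ : Submodule (PathAlgebra K V ⧸ I) U) :=
    fun h => hPx (hPJ x h)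
  have hx0 : x ≠ 0 := fun h => hPx (by rw [h, smul_zero])
  have hspan := hs.span_eq_top_of_notMem hU.2 hxJ
  obtain ⟨W, hW, hWsup⟩ := hm (e a) (hs.isPrimitiveIdempotent a)
  refine ⟨?_, fun hcard => ?_, ?_⟩
  · rintro rfl
    have hW0 : radicalMul _ (e a) = W 0 := hWsup.trans (ciSup_unique (s := W))
    obtain ⟨c, ω, h⟩ := hs.exists_isOneRelation_of_chain hxa hx0 hspan hproj
      (by rw [hW0]; exact (Submodule.chain_iff _).1 (hW 0).2)
    exact (h.alphaLE_two_and_alphaEq_one hs hU.2 hx0).1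
  · obtain ⟨d, β, hβ⟩ := PathAlgebra.radicalMul_eq_span hI hcard
    obtain ⟨c, ω, h⟩ := hs.exists_isOneRelation_of_chain hxa hx0 hspan hproj
      (hs.chain_of_eq_span (d := d) (by
        rw [PathAlgebra.pathClass_mul_pathClass, Quiver.Path.comp_nil]) hβ hW hWsup)
    exact (h.alphaLE_two_and_alphaEq_one hs hU.2 hx0).1
  · rintro rfl hJP
    have hWsup' : radicalMul _ (e a) = W 0 ⊔ W 1 := by
      refine hWsup.trans (le_antisymm (iSup_le fun i => ?_) (sup_le (le_iSup W 0) (le_iSup W 1)))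
      fin_cases i
      · exact le_sup_left
      · exact le_sup_right
    -- For a trivial mast, `J p = 0` says that `J e a = 0`. Then there are no relations and `U`
    -- would be projective.
    by_cases hp0 : p.length = 0
    · exfalso
      obtain rfl := p.eq_of_length_zero hp0
      have hPe : P = e a := by rw [hP, p.eq_nil_of_length_zero hp0]
      refine hs.relationModule_ne_bot hxa hspan hproj (eq_bot_iff.2 fun r hr => ?_)
      obtain ⟨j, hj, rfl⟩ := mem_radicalMul.1 (hs.relationModule_le_radicalMul hxa hx0 hr)
      rw [Submodule.mem_bot, ← hPe, hJP j hj]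
    have hPjac := PathAlgebra.pathClass_mem_jacobson hI p (Nat.pos_of_ne_zero hp0)
    obtain ⟨c, ω, h⟩ := hs.exists_isOneRelation_of_sup hxa hx0 hspan hproj hU.2 (hW 0) (hW 1)
      hWsup' hbP (mem_radicalMul.2 ⟨P, hPjac, hPa⟩) hPx hJP
    exact (h.alphaLE_two_and_alphaEq_one hs hU.2 hx0).2
      (hs.not_isIrreducibleInclusion h hxJ hbP hPa hPjac hPx hJP hPJ)
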